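/- Let $M\subset B(H)$ be a von Neumann algebra with a faithful normal trace state $\tau$, let $1\in B\subset M$ be a W$^*$-subalgebra, let $X=X^*\in M$, and let $p\in M$ be a nonzero projection. Write $B\langle X\rangle$ for the algebra generated by $B$ and $X$, and $E_N$ for the unique trace preserving conditional expectation onto a W$^*$-subalgebra $N$. Assume: (i) $X$ and $p$ are $B$-free: every alternating product of elements of $B\langle X\rangle\cap\ker E_B$ and of $B\langle p\rangle\cap\ker E_B$ lies in $\ker E_B$; (ii) $p$ is independent from $B$ with respect to $\tau$: $p$ commutes with $B$ and $\tau(bp)=\tau(b)\tau(p)$ for all $b\in B$; (iii) $X$ is algebraically free from $B$, and the conjugate variable $\mathcal J(X:B)$ exists with $|\mathcal J(X:B)|_2<\infty$, i.e. there is $J\in L^2(W^*(B\langle X\rangle),\tau)$ such that $\tau(Jm)=(\tau\otimes\tau)(\partial_{X:B}m)$ for all $m\in B\langle X\rangle$, where $\partial_{X:B}:B\langle X\rangle\to B\langle X\rangle\otimes B\langle X\rangle$ is the derivation with $\partial_{X:B}(B)=0$ and $\partial_{X:B}(X)=1\otimes 1$. Put $\alpha=\tau(p)$ and $X_p=\alpha^{-1}pXp$.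 For a unital C$^*$-algebra $K$ let $\mathbb H_+(K)=\{T\in K:\operatorname{Im}T\ge\epsilon 1\text{ for some }\epsilon>0\}$. Then for every $n$ there is an analytic function $F_n:\mathbb H_+(\mathfrak M_n(B))\to\mathbb H_+(\mathfrak M_n(B))$ such that for all $\beta\in\mathbb H_+(\mathfrak M_n(B))$ the element $X_p\otimes I_n-\beta(p\otimes I_n)$ is invertible in $\mathfrak M_n(pMp)$, the element $X\otimes I_n-F_n(\beta)$ is invertible in $\mathfrak M_n(M)$, and $$\alpha^{-1}\,E_{\mathfrak M_n(W^*(B\langle X\rangle))}\Big(\big(X_p\otimes I_n-\beta(p\otimes I_n)\big)^{-1}\Big)=\big(X\otimes I_n-F_n(\beta)\big)^{-1},$$ where the first inverse is taken in $\mathfrak M_n(pMp)$, whose unit is $p\otimes I_n$, and the conditional expectation on $\mathfrak M_n(M)$ preserves the trace $\tau\otimes\operatorname{tr}_n$. -/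

import Mathlib

open scoped ComplexOrder InnerProductSpace TensorProduct ComplexStarModule

/-! ### Von Neumann algebras as C⋆-algebras -/

namespace VonNeumannAlgebra

variable {H : Type*} [NormedAddCommGroup H] [InnerProductSpace ℂ H] [CompleteSpace H]

instance instSMulMemClass : SMulMemClass (VonNeumannAlgebra H) ℂ (H →L[ℂ] H) where
  smul_mem {s} r _ hx := s.toStarSubalgebra.smul_mem hx r

instance instIsClosed (M : VonNeumannAlgebra H) : IsClosed (M : Set (H →L[ℂ] H)) := by
  rw [← M.centralizer_centralizer]
  exact Set.isClosed_centralizer _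

/-- The operator order inherited from `B(H)` makes a von Neumann algebra a star-ordered ring. -/
instance instStarOrderedRing (M : VonNeumannAlgebra H) : StarOrderedRing M := by
  refine StarOrderedRing.of_nonneg_iff'
    (fun h z => add_le_add_right (α := H →L[ℂ] H) h z.1) fun x => ⟨fun hx => ?_, ?_⟩
  · have hx' : (0 : H →L[ℂ] H) ≤ x := hx
    have hs : CFC.sqrt (x : H →L[ℂ] H) ∈ M := by
      rw [← SetLike.mem_coe, ← M.centralizer_centralizer]
      intro c hc
      have : Commute (x : H →L[ℂ] H) c := hc x x.2
      exact (this.cfcₙ_nnreal _).symm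
    refine ⟨⟨_, hs⟩, Subtype.ext ?_⟩
    change (x : H →L[ℂ] H) = star (CFC.sqrt (x : H →L[ℂ] H)) * CFC.sqrt (x : H →L[ℂ] H)
    rw [(CFC.sqrt_nonneg _).star_eq, CFC.sqrt_mul_sqrt_self _ hx']
  · rintro ⟨s, rfl⟩
    exact star_mul_self_nonneg (s : H →L[ℂ] H)

/-- `W*(S)`: the von Neumann algebra generated by a set `S` of operators, i.e. the double
commutant of `S ∪ S*`. -/
noncomputable def generated (S : Set (H →L[ℂ] H)) : VonNeumannAlgebra H where
  toStarSubalgebra := StarSubalgebra.centralizer ℂ (StarSubalgebra.centralizer ℂ S)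
  centralizer_centralizer' := by
    change Set.centralizer (Set.centralizer
      (StarSubalgebra.centralizer ℂ (StarSubalgebra.centralizer ℂ S : Set (H →L[ℂ] H)) :
        Set (H →L[ℂ] H))) = (StarSubalgebra.centralizer ℂ
          (StarSubalgebra.centralizer ℂ S : Set (H →L[ℂ] H)) : Set (H →L[ℂ] H))
    rw [StarSubalgebra.coe_centralizer_centralizer, Set.centralizer_centralizer_centralizer]

/-- The elements of `M` that belong to `N`, as a subalgebra of `M`. For `N ≤ M` this is `N`
itself, regarded inside `M`. -/
def within (N M : VonNeumannAlgebra H) : Subalgebra ℂ M where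
  carrier := {a | (a : H →L[ℂ] H) ∈ N}
  mul_mem' ha hb := mul_mem (S := VonNeumannAlgebra H) ha hb
  add_mem' ha hb := add_mem (S := VonNeumannAlgebra H) ha hb
  algebraMap_mem' r := N.toStarSubalgebra.algebraMap_mem r

/-- `τ` is a faithful normal trace state on `M` (positivity is part of the type of `τ`).
Normality is stated as: `τ` is a countable sum of vector functionals. -/
structure IsFaithfulNormalTraceState {M : VonNeumannAlgebra H} (τ : M →ₚ[ℂ] ℂ) : Prop where
  map_one : τ 1 = 1
  trace : ∀ a b : M, τ (a * b) = τ (b * a)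
  faithful : ∀ a : M, τ (star a * a) = 0 → a = 0
  normal : ∃ ξ : ℕ → H, Summable (fun k => ‖ξ k‖ ^ 2) ∧
    ∀ a : M, HasSum (fun k => ⟪ξ k, (a : H →L[ℂ] H) (ξ k)⟫_ℂ) (τ a)

end VonNeumannAlgebra

namespace FreeCompression

/-! ### Algebraic notions in a complex algebra `K` with a linear functional `φ` -/

section Algebraic

variable {K : Type*} [Ring K] [Algebra ℂ K]

/-- `A⟨X⟩`: the subalgebra generated by `A` and `X`. -/
def polys (A : Subalgebra ℂ K) (X : K) : Subalgebra ℂ K :=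
  Algebra.adjoin ℂ ((A : Set K) ∪ {X})

/-- The multilinear map `(a₀, a₁, …, a_k) ↦ a₀ X a₁ X ⋯ X a_k` on `A^(k+1)`. -/
noncomputable def word (A : Subalgebra ℂ K) (X : K) (k : ℕ) :
    MultilinearMap ℂ (fun _ : Fin (k + 1) => A) K :=
  (MultilinearMap.mkPiAlgebraFin ℂ (k + 1) K).compLinearMap
    (fun j => if j = 0 then A.val.toLinearMap
      else (LinearMap.mulLeft ℂ X) ∘ₗ A.val.toLinearMap)

/-- `X` is algebraically free from `A`: evaluation at `X` of the noncommutative polynomials with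
coefficients in `A` is injective. As a vector space, the algebra `A⟨t⟩` of noncommutative
polynomials (the coproduct of `A` and `ℂ[t]`) is `⨁ₖ A^{⊗(k+1)}`, where `a₀ ⊗ ⋯ ⊗ a_k` stands for
`a₀ t a₁ t ⋯ t a_k`. -/
def AlgebraicallyFree (A : Subalgebra ℂ K) (X : K) : Prop :=
  Function.Injective
    (DirectSum.toModule ℂ ℕ K (fun k => PiTensorProduct.lift (word A X k)) :
      (DirectSum ℕ fun k => ⨂[ℂ] _ : Fin (k + 1), A) →ₗ[ℂ] K)

theorem mem_polys_self (A : Subalgebra ℂ K) (X : K) : X ∈ polys A X :=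
  Algebra.subset_adjoin (Or.inr rfl)

/-- `D` is the free difference quotient `∂_{X:A} : A⟨X⟩ → A⟨X⟩ ⊗ A⟨X⟩`: the derivation that
vanishes on `A` and sends `X` to `1 ⊗ 1`. (Such a `D` is unique.) -/
structure IsFreeDifferenceQuotient (A : Subalgebra ℂ K) (X : K)
    (D : polys A X →ₗ[ℂ] polys A X ⊗[ℂ] polys A X) : Prop where
  leibniz : ∀ f g, D (f * g) = D f * ((1 : polys A X) ⊗ₜ[ℂ] g) + (f ⊗ₜ[ℂ] (1 : polys A X)) * D g
  coeff : ∀ f : polys A X, (f : K) ∈ A → D f = 0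
  map_var : D ⟨X, mem_polys_self A X⟩ = 1 ⊗ₜ[ℂ] 1

/-- The functional `φ ⊗ φ` on `S ⊗ S`. -/
noncomputable def tensorFunctional (φ : K →ₗ[ℂ] ℂ) (S : Subalgebra ℂ K) : S ⊗[ℂ] S →ₗ[ℂ] ℂ :=
  LinearMap.mul' ℂ ℂ ∘ₗ
    TensorProduct.map (φ ∘ₗ S.val.toLinearMap) (φ ∘ₗ S.val.toLinearMap)

/-- `y = E_N(a)`, where `E_N` is the `φ`-preserving conditional expectation onto `N`: it is the
element of `N` with `φ (y b) = φ (a b)` for every `b ∈ N`. -/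
def IsCondExp (φ : K →ₗ[ℂ] ℂ) (N : Set K) (a y : K) : Prop :=
  y ∈ N ∧ ∀ b ∈ N, φ (y * b) = φ (a * b)

/-- A `φ`-preserving map `E` onto `N` with `E (a b) = E a · b` for `b ∈ N` computes `IsCondExp`. -/
theorem IsCondExp.of_map {φ : K →ₗ[ℂ] ℂ} {N : Set K} (E : K → K) (hE : ∀ a, E a ∈ N)
    (hmul : ∀ a, ∀ b ∈ N, E (a * b) = E a * b) (hφ : ∀ a, φ (E a) = φ a) (a : K) :
    IsCondExp φ N a (E a) :=
  ⟨hE a, fun b hb => by rw [← hmul a b hb, hφ]⟩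

/-- For a faithful functional, `IsCondExp` determines the conditional expectation. -/
theorem IsCondExp.unique [StarRing K] {φ : K →ₗ[ℂ] ℂ} (hφ : ∀ a : K, φ (star a * a) = 0 → a = 0)
    (htr : ∀ a b : K, φ (a * b) = φ (b * a)) {N : Set K}
    (hsub : ∀ a ∈ N, ∀ b ∈ N, star (a - b) ∈ N) {a y z : K}
    (hy : IsCondExp φ N a y) (hz : IsCondExp φ N a z) : y = z := by
  refine sub_eq_zero.1 (hφ _ ?_)
  have hb := hsub y hy.1 z hz.1
  rw [htr, sub_mul, map_sub, hy.2 _ hb, hz.2 _ hb, sub_self]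

/-- Freeness of the family of subalgebras `S i` over `A`: every alternating product of elements
with vanishing conditional expectation onto `A` has vanishing conditional expectation onto `A`. -/
def IsFreeOver {ι : Type*} (φ : K →ₗ[ℂ] ℂ) (A : Subalgebra ℂ K) (S : ι → Subalgebra ℂ K) : Prop :=
  ∀ (k : ℕ) (i : Fin (k + 1) → ι) (a : Fin (k + 1) → K),
    (∀ j, a j ∈ S (i j)) → (∀ j : Fin k, i j.castSucc ≠ i j.succ) →
    (∀ j, IsCondExp φ A (a j) 0) → IsCondExp φ A (List.ofFn a).prod 0

/-- The elements `x` and `y` are `A`-free: `A⟨x⟩` and `A⟨y⟩` are free over `A`. -/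
def AreFreeOver (φ : K →ₗ[ℂ] ℂ) (A : Subalgebra ℂ K) (x y : K) : Prop :=
  IsFreeOver φ A ![polys A x, polys A y]

/-- `x` is (classically) independent from `A` with respect to `φ`: the algebras `ℂ[x]` and `A`
commute and `φ` is multiplicative on products of their elements. -/
def IsIndependentFrom (φ : K →ₗ[ℂ] ℂ) (A : Subalgebra ℂ K) (x : K) : Prop :=
  ∀ c ∈ Algebra.adjoin ℂ {x}, ∀ a ∈ A, Commute c a ∧ φ (a * c) = φ a * φ c

/-- For an idempotent `P`: `T` and `R` lie in the corner `P K P` and are inverse to each other in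
this algebra, whose unit is `P`. -/
structure IsCornerInverse (P T R : K) : Prop where
  left_mem : P * T * P = T
  right_mem : P * R * P = R
  mul_eq : T * R = P
  mul_eq' : R * T = P

end Algebraic

/-! ### Matrices and half-planes -/

/-- `x ⊗ I_n`. -/
def amplify {K : Type*} [Zero K] (n : ℕ) (x : K) : CStarMatrix (Fin n) (Fin n) K :=
  CStarMatrix.ofMatrix (Matrix.diagonal fun _ => x)

/-- The functional `φ ⊗ tr_n` on `n × n` matrices, with `tr_n` the normalized trace. -/
noncomputable def matrixFunctional {K : Type*} [Ring K] [Algebra ℂ K] (φ : K →ₗ[ℂ] ℂ) (n : ℕ) :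
    CStarMatrix (Fin n) (Fin n) K →ₗ[ℂ] ℂ where
  toFun T := (n : ℂ)⁻¹ * ∑ i, φ (T i i)
  map_add' S T := by simp [Finset.sum_add_distrib, mul_add]
  map_smul' r T := by simp [← Finset.mul_sum, mul_left_comm]

/-- `𝔐_n(N)`, the matrices with all entries in `N`. -/
def matricesOver {K : Type*} (n : ℕ) (N : Set K) : Set (CStarMatrix (Fin n) (Fin n) K) :=
  {T | ∀ i j, T i j ∈ N}

/-- The upper half-plane `ℍ₊(K)` of a unital C⋆-algebra: the elements `T` such that
`Im T ≥ ε 1` for some `ε > 0`. -/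
def upperHalfPlane (K : Type*) [CStarAlgebra K] [PartialOrder K] [StarOrderedRing K] : Set K :=
  {T | ∃ ε : ℝ, 0 < ε ∧ algebraMap ℝ K ε ≤ (ℑ T : K)}

/-! ### Conjugate variables -/

section Conjugate

variable {H : Type*} [NormedAddCommGroup H] [InnerProductSpace ℂ H] [CompleteSpace H]

/-- `W*(B⟨X⟩)`. -/
noncomputable def wstarPolys {M : VonNeumannAlgebra H} (B : VonNeumannAlgebra H) (X : M) :
    VonNeumannAlgebra H :=
  VonNeumannAlgebra.generated ((fun a : M => (a : H →L[ℂ] H)) '' polys (B.within M) X)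

/-- The canonical map of `M` into `L²(M, τ)`, the completion of `M` for `⟪a, b⟫ = τ (a* b)`. -/
noncomputable def toL2 {M : VonNeumannAlgebra H} (τ : M →ₚ[ℂ] ℂ) (a : M) : τ.GNS :=
  ((τ.toPreGNS a : τ.PreGNS) : UniformSpace.Completion τ.PreGNS)

/-- `X` is algebraically free from `B`, and `J` is the conjugate variable `𝒥(X:B)`, lying in
`L²(W*(B⟨X⟩))` (the closure of `W*(B⟨X⟩)` in `L²(M, τ)`):
`τ (J m) = (τ ⊗ τ) (∂_{X:B} m)` for every `m ∈ B⟨X⟩`. Here `τ (J m)` is `⟪m*, J⟫`. -/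
def IsL2ConjugateVariable {M : VonNeumannAlgebra H} (τ : M →ₚ[ℂ] ℂ) (B : VonNeumannAlgebra H)
    (X : M) (J : τ.GNS) : Prop :=
  AlgebraicallyFree (B.within M) X ∧
  J ∈ closure (toL2 τ '' ((wstarPolys B X).within M : Set M)) ∧
  ∃ D : polys (B.within M) X →ₗ[ℂ] polys (B.within M) X ⊗[ℂ] polys (B.within M) X,
    IsFreeDifferenceQuotient (B.within M) X D ∧
    ∀ m : polys (B.within M) X,
      ⟪toL2 τ (star (m : M)), J⟫_ℂ =
        tensorFunctional τ.toLinearMap (polys (B.within M) X) (D m)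

end Conjugate

end FreeCompression

open FreeCompression

set_option linter.unusedSectionVars false

namespace FreeCompression

/-! ### Half-planes in C⋆-algebras -/

section HalfPlane

variable {K : Type*} [CStarAlgebra K]

/-! Write `R` for the inverse of `α⁻¹ P X P - β P` in the corner, `E` for the conditional
expectation onto the coefficient algebra, `h = α⁻¹ E(R)`, and put `F(β) = α β - (1 - α) h⁻¹`, `S =
(X - F(β))⁻¹`. The imaginary part of `h` is bounded below by a positive constant, hence so is that
of `-h⁻¹`. Thus `F(β)` is a convex combination of two half-plane elements and `S` exists.

The mechanism is one algebraic identity. With `Q = P - α` and `v = h⁻¹ S - 1`, the choice of `F`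
gives `α⁻¹ R = S (α - Q v)⁻¹ P = S + S (α - Q v)⁻¹ Q (1 + v)` whenever `α - Q v` is invertible
(`inv_smul_cornerResolvent_eq`, `inverse_mul_proj`). If `E v = 0` and `v` is small, the Neumann
series of `(α - Q v)⁻¹ Q` consists of alternating words `Q v Q v ⋯ Q`. By freeness these are
orthogonal to the closed algebra `C` generated by the coefficients and `X`, so `α⁻¹ R` and `S` have
the same pairing with `C` (`trace_eq_of_condExp_eq_zero`).

That `E v = 0` is a local uniqueness statement. The definition of `h` says `E(h⁻¹ α⁻¹ R) = 1`.
Comparing `v` with its centered part turns this into a linear equation for `e = E v`, which up to an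
error vanishing with `v` reads `α⁻¹ e = 0` (`condExp_eq_zero_of_small`). At `X = 0` one has `v = 0`,
so everything holds for `z X` with `z` real and small. Both sides are real analytic in `z` on the
whole line, because `z X` stays self-adjoint, and the identity reaches `z = 1`
(`trace_cornerResolvent_eq`).

The argument uses only the axioms collected in `IsCompressionSetting`. These pass to matrices
(`IsCompressionSetting.matrix`), so all `n` are handled at once. For von Neumann algebras, `E` comes
from a Hilbert space projection and a separation argument (`exists_condExp`). Orthogonality to
`B⟨X⟩` passes to `W*(B⟨X⟩)` by the double commutant argument in `orbit_mem_closure`. -/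

theorem coe_imaginaryPart_conj (c T : K) : (ℑ (c * T * star c) : K) = c * (ℑ T : K) * star c := by
  simp only [imaginaryPart_apply_coe, star_mul, star_star, mul_smul_comm, smul_mul_assoc, mul_sub,
    sub_mul, mul_assoc]

theorem coe_imaginaryPart_inverse {T : K} (hT : IsUnit T) :
    (ℑ (-Ring.inverse T) : K) = Ring.inverse T * (ℑ T : K) * star (Ring.inverse T) := by
  have h1 : Ring.inverse T * T = 1 := Ring.inverse_mul_cancel T hT
  have h2 : star T * star (Ring.inverse T) = 1 := by rw [← star_mul, h1, star_one]
  simp only [imaginaryPart_apply_coe, mul_smul_comm, smul_mul_assoc, mul_sub, sub_mul, h1,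
    mul_assoc, h2, star_neg]
  simp [sub_eq_add_neg, add_comm]

variable [PartialOrder K] [StarOrderedRing K]

/-- With `T = a + i b` and `b` positive invertible, `T = b^{1/2} (b^{-1/2} a b^{-1/2} + i) b^{1/2}`.
The middle factor is invertible because a self-adjoint element has real spectrum. -/
theorem isUnit_of_mem_upperHalfPlane {T : K} (hT : T ∈ upperHalfPlane K) : IsUnit T := by
  obtain ⟨ε, hε, h⟩ := hT
  set b : K := (ℑ T : K) with hb
  set a : K := (ℜ T : K) with ha
  have hTab : a + Complex.I • b = T := realPart_add_I_smul_imaginaryPart T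
  have hb0 : 0 ≤ b := le_trans (by
    rw [← map_zero (algebraMap ℝ K)]; exact (algebraMap_mono K) hε.le) h
  have hbu : IsUnit b := by
    refine CStarAlgebra.isUnit_of_le (algebraMap ℝ K ε) h ?_
    rw [IsStrictlyPositive.iff_of_unital]
    refine ⟨?_, (isUnit_iff_ne_zero.2 hε.ne').map (algebraMap ℝ K)⟩
    rw [← map_zero (algebraMap ℝ K)]; exact (algebraMap_mono K) hε.le
  have hg2 : CFC.sqrt b * CFC.sqrt b = b := CFC.sqrt_mul_sqrt_self b hb0
  have hgu : IsUnit (CFC.sqrt b) := (CFC.isUnit_sqrt_iff b hb0).2 hbu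
  have hgs : star (CFC.sqrt b) = CFC.sqrt b := (CFC.sqrt_nonneg b).isSelfAdjoint.star_eq
  obtain ⟨u, hu⟩ := hgu
  rw [← hu] at hg2 hgs
  have hus : star (↑u⁻¹ : K) = ↑u⁻¹ := by
    have : star (↑u⁻¹ : K) * u = 1 := by
      rw [← hgs, ← star_mul]; simp
    rw [← mul_one (star (↑u⁻¹ : K)), ← u.mul_inv, ← mul_assoc, this, one_mul]
  have hc : IsSelfAdjoint (↑u⁻¹ * a * ↑u⁻¹ : K) := by
    rw [isSelfAdjoint_iff]; simp [hus, mul_assoc, ha]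
  have hcu : IsUnit (↑u⁻¹ * a * ↑u⁻¹ + algebraMap ℂ K Complex.I) := by
    by_contra hcon
    have hm : -Complex.I ∈ spectrum ℂ (↑u⁻¹ * a * ↑u⁻¹ : K) := by
      rw [spectrum.mem_iff]
      intro hh
      apply hcon
      have := hh.neg
      simpa [sub_eq_add_neg, add_comm] using this
    have := hc.im_eq_zero_of_mem_spectrum hm
    simp at this
  have : T = u * (↑u⁻¹ * a * ↑u⁻¹ + algebraMap ℂ K Complex.I) * u := by
    rw [← hTab, ← hg2, Algebra.algebraMap_eq_smul_one]
    simp [mul_add, add_mul, mul_assoc]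
  rw [this]
  exact (u.isUnit.mul hcu).mul u.isUnit

/-- `Im(-T⁻¹) = T⁻¹ (Im T) (T⁻¹)*` dominates `ε T⁻¹ (T⁻¹)*`, and `T T* ≤ ‖T‖² + 1` bounds the latter
from below. The summand `1` keeps the constant meaningful in the zero algebra. -/
theorem neg_inverse_mem_upperHalfPlane {T : K} (hT : T ∈ upperHalfPlane K) :
    -Ring.inverse T ∈ upperHalfPlane K := by
  have hu := isUnit_of_mem_upperHalfPlane hT
  obtain ⟨ε, hε, h⟩ := hT
  have h1 : Ring.inverse T * T = 1 := Ring.inverse_mul_cancel T hu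
  have h2 : star T * star (Ring.inverse T) = 1 := by rw [← star_mul, h1, star_one]
  have hN : (0 : ℝ) < ‖T‖ ^ 2 + 1 := by positivity
  refine ⟨ε * (‖T‖ ^ 2 + 1)⁻¹, by positivity, ?_⟩
  rw [coe_imaginaryPart_inverse hu]
  refine le_trans ?_ (star_right_conjugate_le_conjugate h (Ring.inverse T))
  have h3 : T * star T ≤ algebraMap ℝ K (‖T‖ ^ 2 + 1) := by
    have := CStarAlgebra.mul_star_le_algebraMap_norm_sq (a := T)
    exact this.trans (algebraMap_mono K (by linarith))
  have h4 := star_right_conjugate_le_conjugate h3 (Ring.inverse T)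
  have h5 : Ring.inverse T * (T * star T) * star (Ring.inverse T) = 1 := by
    rw [← mul_assoc, h1, one_mul, h2]
  rw [h5] at h4
  have h6 := smul_le_smul_of_nonneg_left h4 (show 0 ≤ ε * (‖T‖ ^ 2 + 1)⁻¹ by positivity)
  simp only [Algebra.algebraMap_eq_smul_one, mul_smul_comm, smul_mul_assoc, mul_one, smul_smul]
    at h6 ⊢
  rwa [mul_assoc, inv_mul_cancel₀ hN.ne', mul_one] at h6

theorem pos_combination_mem_upperHalfPlane {S T : K} (hS : S ∈ upperHalfPlane K)
    (hT : T ∈ upperHalfPlane K) {s t : ℝ} (hs : 0 < s) (ht : 0 ≤ t) :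
    (s : ℂ) • S + (t : ℂ) • T ∈ upperHalfPlane K := by
  obtain ⟨ε, hε, h⟩ := hS
  obtain ⟨δ, hδ, h'⟩ := hT
  refine ⟨s * ε + t * δ, by positivity, ?_⟩
  have := add_le_add (smul_le_smul_of_nonneg_left h hs.le) (smul_le_smul_of_nonneg_left h' ht)
  simpa [map_add, Algebra.algebraMap_eq_smul_one, add_smul, mul_smul, Complex.coe_smul] using this

end HalfPlane

/-! ### Free compression in an abstract tracial setting -/

section Abstract

variable {𝔐 𝔅 : Type*} [CStarAlgebra 𝔐] [PartialOrder 𝔐] [StarOrderedRing 𝔐]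
  [CStarAlgebra 𝔅] [PartialOrder 𝔅] [StarOrderedRing 𝔅]

/-- `E` is a trace preserving conditional expectation of `𝔐` onto `𝔅`, `P` is a projection of
trace `α` independent from `𝔅`, and `C ⊇ 𝔅` is a closed subalgebra free from `P` over `𝔅`: `𝒬`
contains the alternating products of `P - α` and centered elements of `C` that begin and end with
`P - α`, and is orthogonal to `C`. -/
structure IsCompressionSetting (ι : 𝔅 →⋆ₐ[ℂ] 𝔐) (τ : 𝔐 →L[ℂ] ℂ) (E : 𝔐 →L[ℂ] 𝔅) (P : 𝔐) (α : ℝ)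
    (C : Subalgebra ℂ 𝔐) (𝒬 : Submodule ℂ 𝔐) : Prop where
  trace : ∀ a b, τ (a * b) = τ (b * a)
  trace_star : ∀ a, τ (star a) = star (τ a)
  nonneg : ∀ a, 0 ≤ τ (star a * a)
  faithful : ∀ b : 𝔅, τ (ι (star b * b)) = 0 → b = 0
  condExp : ∀ a b, τ (ι (E a) * ι b) = τ (a * ι b)
  isStarProjection : IsStarProjection P
  comm : ∀ b, P * ι b = ι b * P
  indep : ∀ b, τ (P * ι b) = α * τ (ι b)
  pos : 0 < α
  le_one : α ≤ 1
  isClosed_subalgebra : IsClosed (C : Set 𝔐)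
  range_le : ∀ b, ι b ∈ C
  isClosed_submodule : IsClosed (𝒬 : Set 𝔐)
  sub_mem : P - (α : ℂ) • 1 ∈ 𝒬
  mul_mem : ∀ w ∈ 𝒬, ∀ v ∈ C, E v = 0 → (P - (α : ℂ) • 1) * v * w ∈ 𝒬
  vanish : ∀ w ∈ 𝒬, ∀ m ∈ C, τ (w * m) = 0

/-! ### Uniqueness and positivity of the conditional expectation -/

namespace IsCompressionSetting

variable {ι : 𝔅 →⋆ₐ[ℂ] 𝔐} {τ : 𝔐 →L[ℂ] ℂ} {E : 𝔐 →L[ℂ] 𝔅} {P : 𝔐} {α : ℝ}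
  {C : Subalgebra ℂ 𝔐} {𝒬 : Submodule ℂ 𝔐}

theorem eq_of_forall (hS : IsCompressionSetting ι τ E P α C 𝒬) {y z : 𝔅}
    (h : ∀ b, τ (ι y * ι b) = τ (ι z * ι b)) : y = z := by
  refine sub_eq_zero.1 (hS.faithful _ ?_)
  rw [map_mul, hS.trace, map_sub, sub_mul, map_sub, h, sub_self]

theorem condExp_eq (hS : IsCompressionSetting ι τ E P α C 𝒬) {a : 𝔐} {y : 𝔅}
    (h : ∀ b, τ (a * ι b) = τ (ι y * ι b)) : E a = y :=
  hS.eq_of_forall fun b => by rw [hS.condExp, h]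

theorem condExp_star (hS : IsCompressionSetting ι τ E P α C 𝒬) (a : 𝔐) :
    E (star a) = star (E a) := by
  refine hS.condExp_eq fun b => ?_
  have h1 : star a * ι b = star (ι (star b) * a) := by simp [map_star]
  have h2 : ι (star (E a)) * ι b = star (ι (star b) * ι (E a)) := by simp [map_star]
  rw [h1, h2, hS.trace_star, hS.trace_star, hS.trace, ← hS.condExp, hS.trace]

theorem condExp_proj (hS : IsCompressionSetting ι τ E P α C 𝒬) : E P = (α : ℂ) • 1 :=
  hS.condExp_eq fun b => by
    rw [hS.indep, map_smul, map_one, smul_mul_assoc, one_mul, map_smul, smul_eq_mul]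

theorem trace_nonneg (hS : IsCompressionSetting ι τ E P α C 𝒬) {a : 𝔐} (ha : 0 ≤ a) :
    0 ≤ τ a := by
  obtain ⟨s, rfl⟩ := (CStarAlgebra.nonneg_iff_eq_star_mul_self).1 ha
  exact hS.nonneg s

/-- Testing with `d = y⁻` gives `-τ((y⁻)³) ≥ 0`, so faithfulness forces `(y⁻)³ = 0` and hence `y⁻ =
0`. This yields positivity of `E` from trace duality alone. -/
theorem nonneg_of_trace (hS : IsCompressionSetting ι τ E P α C 𝒬) {y : 𝔅} (hy : IsSelfAdjoint y)
    (h : ∀ d, 0 ≤ τ (ι (d * y * star d))) : 0 ≤ y := by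
  have hn : 0 ≤ y⁻ := CFC.negPart_nonneg y
  have hns : star y⁻ = y⁻ := hn.isSelfAdjoint.star_eq
  have hdec : y⁺ - y⁻ = y := CFC.posPart_sub_negPart y hy
  have hy2 : y⁻ * y = -(y⁻ * y⁻) := by
    nth_rewrite 2 [← hdec]
    rw [mul_sub, CFC.negPart_mul_posPart, zero_sub]
  set g := CFC.sqrt y⁻ * y⁻ with hg
  have hgg : star g * g = y⁻ * y⁻ * y⁻ := by
    rw [hg, star_mul, hns, (CFC.sqrt_nonneg y⁻).isSelfAdjoint.star_eq,
      show y⁻ * CFC.sqrt y⁻ * (CFC.sqrt y⁻ * y⁻) = y⁻ * (CFC.sqrt y⁻ * CFC.sqrt y⁻) * y⁻ by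
        simp only [mul_assoc], CFC.sqrt_mul_sqrt_self _ hn]
  have h1 := h y⁻
  rw [hns, hy2, neg_mul, ← hgg, map_neg, map_neg] at h1
  have h2 : 0 ≤ τ (ι (star g * g)) := by
    rw [map_mul, map_star]; exact hS.nonneg _
  have h3 : g = 0 := hS.faithful g (le_antisymm (neg_nonneg.1 h1) h2)
  rw [h3, mul_zero] at hgg
  have h4 : star (y⁻ * y⁻) * (y⁻ * y⁻) = 0 := by
    rw [star_mul, hns, ← mul_assoc, ← hgg, zero_mul]
  have h5 : star y⁻ * y⁻ = 0 := by
    rw [hns]; exact CStarRing.star_mul_self_eq_zero_iff _ |>.1 h4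
  have h6 : y⁻ = 0 := CStarRing.star_mul_self_eq_zero_iff _ |>.1 h5
  rw [← hdec, h6, sub_zero]
  exact CFC.posPart_nonneg y

theorem condExp_nonneg (hS : IsCompressionSetting ι τ E P α C 𝒬) {a : 𝔐} (ha : 0 ≤ a) :
    0 ≤ E a := by
  refine hS.nonneg_of_trace (by rw [isSelfAdjoint_iff, ← hS.condExp_star,
    ha.isSelfAdjoint.star_eq]) fun d => ?_
  have : τ (ι (d * E a * star d)) = τ (ι d * a * star (ι d)) := by
    rw [map_mul ι, map_mul ι, mul_assoc, hS.trace, mul_assoc, ← map_mul ι, hS.condExp, map_mul ι,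
      ← mul_assoc, hS.trace, ← mul_assoc, map_star]
  rw [this]
  exact hS.trace_nonneg (star_right_conjugate_nonneg ha _)

theorem condExp_mono (hS : IsCompressionSetting ι τ E P α C 𝒬) {a b : 𝔐} (h : a ≤ b) :
    E a ≤ E b := by
  have := hS.condExp_nonneg (sub_nonneg.2 h)
  rwa [map_sub, sub_nonneg] at this

theorem imaginaryPart_condExp (hS : IsCompressionSetting ι τ E P α C 𝒬) (a : 𝔐) :
    (ℑ (E a) : 𝔅) = E (ℑ a : 𝔐) := by
  simp only [imaginaryPart_apply_coe, ← hS.condExp_star, ← map_sub]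
  rw [map_smul, ← Complex.coe_smul, ← Complex.coe_smul, map_smul]

end IsCompressionSetting

/-! ### Corner resolvent, Cauchy transform and subordination function -/

section Functions

variable (ι : 𝔅 →⋆ₐ[ℂ] 𝔐) (E : 𝔐 →L[ℂ] 𝔅) (P : 𝔐) (α : ℝ)

/-- `α⁻¹ P X P - β P`, made invertible on the complement of `P`. -/
noncomputable def cornerShift (X : 𝔐) (β : 𝔅) : 𝔐 :=
  (α : ℂ)⁻¹ • (P * X * P) - ι β * P - Complex.I • (1 - P)

/-- The inverse of `α⁻¹ P X P - β P` in the corner `P 𝔐 P`. -/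
noncomputable def cornerResolvent (X : 𝔐) (β : 𝔅) : 𝔐 :=
  Ring.inverse (cornerShift ι P α X β) * P

/-- The `𝔅`-valued Cauchy transform (up to sign) of the compression of `X`. -/
noncomputable def cornerCauchy (X : 𝔐) (β : 𝔅) : 𝔅 :=
  (α : ℂ)⁻¹ • E (cornerResolvent ι P α X β)

/-- The subordination function of the compression. -/
noncomputable def subordination (X : 𝔐) (β : 𝔅) : 𝔅 :=
  (α : ℂ) • β + ((1 - α : ℝ) : ℂ) • -Ring.inverse (cornerCauchy ι E P α X β)

/-- The resolvent of `X` at the value of the subordination function. -/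
noncomputable def subordinateResolvent (X : 𝔐) (β : 𝔅) : 𝔐 :=
  Ring.inverse (X - ι (subordination ι E P α X β))

end Functions

/-! ### Half-plane estimates and analyticity -/

namespace IsCompressionSetting

variable {ι : 𝔅 →⋆ₐ[ℂ] 𝔐} {τ : 𝔐 →L[ℂ] ℂ} {E : 𝔐 →L[ℂ] 𝔅} {P : 𝔐} {α : ℝ}
  {C : Subalgebra ℂ 𝔐} {𝒬 : Submodule ℂ 𝔐}

theorem coe_imaginaryPart_starAlgHom (ι : 𝔅 →⋆ₐ[ℂ] 𝔐) (b : 𝔅) :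
    (ℑ (ι b) : 𝔐) = ι (ℑ b : 𝔅) := by
  simp only [imaginaryPart_apply_coe, ← map_star, ← map_sub]
  rw [map_smul, ← Complex.coe_smul, ← Complex.coe_smul, map_smul]

theorem map_mem_upperHalfPlane (ι : 𝔅 →⋆ₐ[ℂ] 𝔐) {b : 𝔅} (hb : b ∈ upperHalfPlane 𝔅) :
    ι b ∈ upperHalfPlane 𝔐 := by
  obtain ⟨ε, hε, h⟩ := hb
  refine ⟨ε, hε, ?_⟩
  rw [coe_imaginaryPart_starAlgHom]
  have := OrderHomClass.mono ι h
  rwa [Algebra.algebraMap_eq_smul_one, ← Complex.coe_smul, map_smul, map_one, Complex.coe_smul,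
    ← Algebra.algebraMap_eq_smul_one] at this

theorem neg_cornerShift_mem (hS : IsCompressionSetting ι τ E P α C 𝒬) {X : 𝔐}
    (hX : IsSelfAdjoint X) {β : 𝔅} (hβ : β ∈ upperHalfPlane 𝔅) :
    -cornerShift ι P α X β ∈ upperHalfPlane 𝔐 := by
  obtain ⟨ε, hε, h⟩ := map_mem_upperHalfPlane ι hβ
  have hPs : star P = P := hS.isStarProjection.isSelfAdjoint.star_eq
  have hPP : P * P = P := hS.isStarProjection.isIdempotentElem
  -- The imaginary part is at least `ε` on the range of `P` and equals `1` on its complement, thanks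
  -- to the term `-i (1 - P)` in the shift.
  refine ⟨min ε 1, by positivity, ?_⟩
  have hIm : (ℑ (-cornerShift ι P α X β) : 𝔐) = P * (ℑ (ι β) : 𝔐) * P + (1 - P) := by
    have h1 : ι β * P = P * ι β * star P := by rw [hPs, mul_assoc, ← hS.comm, ← mul_assoc, hPP]
    have h2 : ℑ ((α : ℂ)⁻¹ • (P * X * P)) = 0 := by
      have : IsSelfAdjoint ((α : ℂ)⁻¹ • (P * X * P)) := by
        rw [isSelfAdjoint_iff, star_smul, star_mul, star_mul, hPs, hX.star_eq, mul_assoc]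
        simp
      exact this.imaginaryPart
    have h3 : (ℑ (Complex.I • (1 - P)) : 𝔐) = 1 - P := by
      rw [imaginaryPart_I_smul]
      have : IsSelfAdjoint (1 - P) := (IsSelfAdjoint.one _).sub hS.isStarProjection.isSelfAdjoint
      exact this.coe_realPart
    rw [cornerShift, map_neg, map_sub, map_sub, h2, h1]
    push_cast
    rw [coe_imaginaryPart_conj, h3, hPs]
    abel
  rw [hIm]
  have h1P : (0 : 𝔐) ≤ 1 - P := hS.isStarProjection.one_sub.nonneg
  have h0P : (0 : 𝔐) ≤ P := hS.isStarProjection.nonneg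
  calc algebraMap ℝ 𝔐 (min ε 1) = (min ε 1) • P + (min ε 1) • (1 - P) := by
        rw [← smul_add, add_sub_cancel, Algebra.algebraMap_eq_smul_one]
    _ ≤ ε • P + (1 : ℝ) • (1 - P) :=
        add_le_add (smul_le_smul_of_nonneg_right (min_le_left _ _) h0P)
          (smul_le_smul_of_nonneg_right (min_le_right _ _) h1P)
    _ = P * algebraMap ℝ 𝔐 ε * star P + (1 - P) := by
        rw [hPs, Algebra.algebraMap_eq_smul_one, mul_smul_comm, smul_mul_assoc, mul_one, hPP,
          one_smul]
    _ ≤ P * (ℑ (ι β) : 𝔐) * P + (1 - P) := by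
        have := star_right_conjugate_le_conjugate h P
        rw [hPs] at this ⊢
        gcongr

theorem isUnit_cornerShift (hS : IsCompressionSetting ι τ E P α C 𝒬) {X : 𝔐}
    (hX : IsSelfAdjoint X) {β : 𝔅} (hβ : β ∈ upperHalfPlane 𝔅) :
    IsUnit (cornerShift ι P α X β) := by
  have := (isUnit_of_mem_upperHalfPlane (hS.neg_cornerShift_mem hX hβ)).neg
  rwa [neg_neg] at this

theorem commute_cornerShift (hS : IsCompressionSetting ι τ E P α C 𝒬) (X : 𝔐) (β : 𝔅) :
    Commute P (cornerShift ι P α X β) := by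
  have hPP : P * P = P := hS.isStarProjection.isIdempotentElem
  have hPP' (a : 𝔐) : P * (P * a) = P * a := by rw [← mul_assoc, hPP]
  simp [commute_iff_eq, cornerShift, mul_sub, sub_mul, mul_assoc, hPP, hPP', ← hS.comm]

theorem commute_ringInverse_right {A : Type*} [Ring A] {a b : A} (h : Commute a b) :
    Commute a (Ring.inverse b) := by
  by_cases hb : IsUnit b
  · obtain ⟨u, rfl⟩ := hb
    rw [Ring.inverse_unit]
    exact h.units_inv_right
  · rw [Ring.inverse_non_unit _ hb]
    exact Commute.zero_right a

theorem commute_inverse_cornerShift (hS : IsCompressionSetting ι τ E P α C 𝒬) (X : 𝔐) (β : 𝔅) :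
    P * Ring.inverse (cornerShift ι P α X β) = Ring.inverse (cornerShift ι P α X β) * P :=
  commute_ringInverse_right (hS.commute_cornerShift X β)

theorem isCornerInverse_cornerResolvent (hS : IsCompressionSetting ι τ E P α C 𝒬) {X : 𝔐}
    (hX : IsSelfAdjoint X) {β : 𝔅} (hβ : β ∈ upperHalfPlane 𝔅) :
    IsCornerInverse P ((α : ℂ)⁻¹ • (P * X * P) - ι β * P) (cornerResolvent ι P α X β) := by
  have hPP : P * P = P := hS.isStarProjection.isIdempotentElem
  have hPP' (a : 𝔐) : P * (P * a) = P * a := by rw [← mul_assoc, hPP]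
  have hu := hS.isUnit_cornerShift hX hβ
  have h1 : cornerShift ι P α X β * P = (α : ℂ)⁻¹ • (P * X * P) - ι β * P := by
    simp [cornerShift, sub_mul, mul_assoc, hPP]
  have hc := hS.commute_inverse_cornerShift X β
  have hc' := (hS.commute_cornerShift X β).eq
  rw [← h1]
  constructor
  · rw [← mul_assoc, hc', mul_assoc _ P P, hPP, mul_assoc, hPP]
  · rw [cornerResolvent, ← mul_assoc, hc, mul_assoc _ P P, hPP, mul_assoc, hPP]
  · rw [cornerResolvent, mul_assoc, ← mul_assoc P, hc, mul_assoc _ P P, hPP, ← mul_assoc,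
      Ring.mul_inverse_cancel _ hu, one_mul]
  · rw [cornerResolvent, mul_assoc, ← mul_assoc P, hc', mul_assoc _ P P, hPP, ← mul_assoc,
      Ring.inverse_mul_cancel _ hu, one_mul]

/-- A lower bound `c` for the imaginary part of the inverse of the shift compresses to `Im R ≥ c P`.
Since `E P = α`, applying `α⁻¹ E` returns the same constant `c`. -/
theorem cornerCauchy_mem (hS : IsCompressionSetting ι τ E P α C 𝒬) {X : 𝔐}
    (hX : IsSelfAdjoint X) {β : 𝔅} (hβ : β ∈ upperHalfPlane 𝔅) :
    cornerCauchy ι E P α X β ∈ upperHalfPlane 𝔅 := by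
  obtain ⟨c, hc, h⟩ := neg_inverse_mem_upperHalfPlane (hS.neg_cornerShift_mem hX hβ)
  have hneg : -Ring.inverse (-cornerShift ι P α X β) = Ring.inverse (cornerShift ι P α X β) := by
    obtain ⟨u, hu⟩ := hS.isUnit_cornerShift hX hβ
    rw [← hu, ← Units.val_neg, Ring.inverse_unit, Ring.inverse_unit, inv_neg, Units.val_neg,
      neg_neg]
  rw [hneg] at h
  have hPs : star P = P := hS.isStarProjection.isSelfAdjoint.star_eq
  have hPP : P * P = P := hS.isStarProjection.isIdempotentElem
  have hR : cornerResolvent ι P α X β = P * Ring.inverse (cornerShift ι P α X β) * star P := by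
    rw [hPs, hS.commute_inverse_cornerShift, mul_assoc, hPP, cornerResolvent]
  refine ⟨c, hc, ?_⟩
  have h1 : c • P ≤ (ℑ (cornerResolvent ι P α X β) : 𝔐) := by
    rw [hR, coe_imaginaryPart_conj]
    refine le_trans (le_of_eq ?_) (star_right_conjugate_le_conjugate h P)
    rw [hPs, Algebra.algebraMap_eq_smul_one, mul_smul_comm, smul_mul_assoc, mul_one, hPP]
  have h2 := hS.condExp_mono h1
  rw [← Complex.coe_smul, map_smul, hS.condExp_proj, ← hS.imaginaryPart_condExp,
    Complex.coe_smul, Complex.coe_smul] at h2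
  have h3 := smul_le_smul_of_nonneg_left h2 (inv_nonneg.2 hS.pos.le)
  rw [smul_comm, inv_smul_smul₀ hS.pos.ne', ← Algebra.algebraMap_eq_smul_one] at h3
  refine h3.trans (le_of_eq ?_)
  rw [cornerCauchy, ← Complex.ofReal_inv, Complex.coe_smul, map_smul]
  rfl

theorem isUnit_cornerCauchy (hS : IsCompressionSetting ι τ E P α C 𝒬) {X : 𝔐}
    (hX : IsSelfAdjoint X) {β : 𝔅} (hβ : β ∈ upperHalfPlane 𝔅) :
    IsUnit (cornerCauchy ι E P α X β) :=
  isUnit_of_mem_upperHalfPlane (hS.cornerCauchy_mem hX hβ)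

theorem subordination_mem (hS : IsCompressionSetting ι τ E P α C 𝒬) {X : 𝔐}
    (hX : IsSelfAdjoint X) {β : 𝔅} (hβ : β ∈ upperHalfPlane 𝔅) :
    subordination ι E P α X β ∈ upperHalfPlane 𝔅 :=
  pos_combination_mem_upperHalfPlane hβ
    (neg_inverse_mem_upperHalfPlane (hS.cornerCauchy_mem hX hβ)) hS.pos (by linarith [hS.le_one])

theorem isUnit_sub_subordination (hS : IsCompressionSetting ι τ E P α C 𝒬) {X : 𝔐}
    (hX : IsSelfAdjoint X) {β : 𝔅} (hβ : β ∈ upperHalfPlane 𝔅) :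
    IsUnit (X - ι (subordination ι E P α X β)) := by
  obtain ⟨ε, hε, h⟩ := map_mem_upperHalfPlane ι (hS.subordination_mem hX hβ)
  have : -(X - ι (subordination ι E P α X β)) ∈ upperHalfPlane 𝔐 := by
    refine ⟨ε, hε, ?_⟩
    rw [neg_sub, map_sub, hX.imaginaryPart, sub_zero]
    exact h
  rw [← IsUnit.neg_iff]
  exact isUnit_of_mem_upperHalfPlane this

/-! #### Analyticity -/

theorem analyticAt_ringInverse_comp {𝕜 V A : Type*} [NontriviallyNormedField 𝕜]
    [NormedAddCommGroup V] [NormedSpace 𝕜 V] [NormedRing A] [NormedAlgebra 𝕜 A]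
    [HasSummableGeomSeries A] {f : V → A} {x : V} (hf : AnalyticAt 𝕜 f x) (hu : IsUnit (f x)) :
    AnalyticAt 𝕜 (fun y => Ring.inverse (f y)) x := by
  obtain ⟨u, hu⟩ := hu
  have := analyticAt_inverse (𝕜 := 𝕜) u
  rw [hu] at this
  exact this.comp hf

/-- Joint analyticity serves twice: in `β` for the subordination function, and in `X` for the
continuation along `z • X`. -/
theorem analyticAt_cornerResolvent (hS : IsCompressionSetting ι τ E P α C 𝒬) {X : 𝔐}
    (hX : IsSelfAdjoint X) {β : 𝔅} (hβ : β ∈ upperHalfPlane 𝔅) :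
    AnalyticAt ℂ (fun x : 𝔐 × 𝔅 => cornerResolvent ι P α x.1 x.2) (X, β) := by
  have hι : AnalyticAt ℂ (fun x : 𝔐 × 𝔅 => ι x.2) (X, β) :=
    ((⟨ι.toLinearMap, map_continuous ι⟩ : 𝔅 →L[ℂ] 𝔐).analyticAt β).comp analyticAt_snd
  refine (analyticAt_ringInverse_comp
    (f := fun x : 𝔐 × 𝔅 => cornerShift ι P α x.1 x.2) ?_ (hS.isUnit_cornerShift hX hβ)).mul
    analyticAt_const
  have h1 : AnalyticAt ℂ (fun x : 𝔐 × 𝔅 => P * x.1 * P) (X, β) :=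
    (analyticAt_const.mul analyticAt_fst).mul analyticAt_const
  exact (((h1.const_smul (c := (α : ℂ)⁻¹)).sub (hι.mul analyticAt_const))).sub analyticAt_const

theorem analyticAt_cornerCauchy (hS : IsCompressionSetting ι τ E P α C 𝒬) {X : 𝔐}
    (hX : IsSelfAdjoint X) {β : 𝔅} (hβ : β ∈ upperHalfPlane 𝔅) :
    AnalyticAt ℂ (fun x : 𝔐 × 𝔅 => cornerCauchy ι E P α x.1 x.2) (X, β) :=
  ((E.analyticAt _).comp (hS.analyticAt_cornerResolvent hX hβ)).const_smul (c := (α : ℂ)⁻¹)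

theorem analyticAt_subordination (hS : IsCompressionSetting ι τ E P α C 𝒬) {X : 𝔐}
    (hX : IsSelfAdjoint X) {β : 𝔅} (hβ : β ∈ upperHalfPlane 𝔅) :
    AnalyticAt ℂ (fun x : 𝔐 × 𝔅 => subordination ι E P α x.1 x.2) (X, β) :=
  (analyticAt_snd.const_smul (c := (α : ℂ))).add ((analyticAt_ringInverse_comp
    (hS.analyticAt_cornerCauchy hX hβ) (hS.isUnit_cornerCauchy hX hβ)).neg.const_smul
      (c := ((1 - α : ℝ) : ℂ)))

theorem analyticAt_subordinateResolvent (hS : IsCompressionSetting ι τ E P α C 𝒬) {X : 𝔐}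
    (hX : IsSelfAdjoint X) {β : 𝔅} (hβ : β ∈ upperHalfPlane 𝔅) :
    AnalyticAt ℂ (fun x : 𝔐 × 𝔅 => subordinateResolvent ι E P α x.1 x.2) (X, β) := by
  refine analyticAt_ringInverse_comp ?_ (hS.isUnit_sub_subordination hX hβ)
  exact analyticAt_fst.sub (((⟨ι.toLinearMap, map_continuous ι⟩ : 𝔅 →L[ℂ] 𝔐).analyticAt _).comp
    (hS.analyticAt_subordination hX hβ))

theorem analyticOnNhd_subordination (hS : IsCompressionSetting ι τ E P α C 𝒬) {X : 𝔐}
    (hX : IsSelfAdjoint X) :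
    AnalyticOnNhd ℂ (subordination ι E P α X) (upperHalfPlane 𝔅) := fun _ hβ =>
  (hS.analyticAt_subordination hX hβ).comp_of_eq (analyticAt_const.prod analyticAt_id) rfl

end IsCompressionSetting
end Abstract
-- The algebraic identity and its consequences under freeness
section Core

variable {𝔐 𝔅 : Type*} [CStarAlgebra 𝔐] [PartialOrder 𝔐] [StarOrderedRing 𝔐]
  [CStarAlgebra 𝔅] [PartialOrder 𝔅] [StarOrderedRing 𝔅]

namespace IsCompressionSetting

variable {ι : 𝔅 →⋆ₐ[ℂ] 𝔐} {τ : 𝔐 →L[ℂ] ℂ} {E : 𝔐 →L[ℂ] 𝔅} {P : 𝔐} {α : ℝ}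
  {C : Subalgebra ℂ 𝔐} {𝒬 : Submodule ℂ 𝔐}

/-! #### The compressed resolvent in terms of the subordinate resolvent -/

theorem sub_smul_mul_subordinateResolvent (hS : IsCompressionSetting ι τ E P α C 𝒬) {X : 𝔐}
    (hX : IsSelfAdjoint X) {β : 𝔅} (hβ : β ∈ upperHalfPlane 𝔅) :
    (X - (α : ℂ) • ι β) * subordinateResolvent ι E P α X β =
      1 - ((1 - α : ℝ) : ℂ) • (ι (Ring.inverse (cornerCauchy ι E P α X β)) *
        subordinateResolvent ι E P α X β) := by
  have h1 : (X - ι (subordination ι E P α X β)) * subordinateResolvent ι E P α X β = 1 :=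
    Ring.mul_inverse_cancel _ (hS.isUnit_sub_subordination hX hβ)
  have h2 : X - (α : ℂ) • ι β = (X - ι (subordination ι E P α X β)) -
      ((1 - α : ℝ) : ℂ) • ι (Ring.inverse (cornerCauchy ι E P α X β)) := by
    rw [subordination, map_add, map_smul, map_smul, map_neg]
    module
  rw [h2, sub_mul, h1, smul_mul_assoc]

/-- The operator `N = α (1 - P) h⁻¹ + P (X - α β)` agrees with `P (X - α β)` in its `P`-row, and its
other row is chosen so that `N S = α - Q v`, where `Q = P - α`. Thus `Z = S (α - Q v)⁻¹` is a right
inverse of `N`. Reading `N Z P = P` row by row shows that `Z P` lies in the corner and inverts `P (X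
- α β) P` there. -/
theorem inv_smul_cornerResolvent_eq (hS : IsCompressionSetting ι τ E P α C 𝒬) {X : 𝔐}
    (hX : IsSelfAdjoint X) {β : 𝔅} (hβ : β ∈ upperHalfPlane 𝔅) {v : 𝔐}
    (hv : v = ι (Ring.inverse (cornerCauchy ι E P α X β)) * subordinateResolvent ι E P α X β - 1)
    (hu : IsUnit ((α : ℂ) • 1 - (P - (α : ℂ) • 1) * v)) :
    (α : ℂ)⁻¹ • cornerResolvent ι P α X β = subordinateResolvent ι E P α X β *
      Ring.inverse ((α : ℂ) • 1 - (P - (α : ℂ) • 1) * v) * P := by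
  have hα : (α : ℂ) ≠ 0 := Complex.ofReal_ne_zero.2 hS.pos.ne'
  have hPP : P * P = P := hS.isStarProjection.isIdempotentElem
  have hkey := hS.sub_smul_mul_subordinateResolvent hX hβ
  set S := subordinateResolvent ι E P α X β with hSdef
  set h := cornerCauchy ι E P α X β with hh
  have hhu : IsUnit h := hS.isUnit_cornerCauchy hX hβ
  set u := ι (Ring.inverse h) * S with hudef
  set Z := S * Ring.inverse ((α : ℂ) • 1 - (P - (α : ℂ) • 1) * v) with hZ
  have hN : ((α : ℂ) • ((1 - P) * ι (Ring.inverse h)) + P * (X - (α : ℂ) • ι β)) * Z = 1 := by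
    rw [hZ, ← mul_assoc, add_mul, mul_assoc P, hkey, smul_mul_assoc, mul_assoc (1 - P), ← hudef]
    have : (α : ℂ) • ((1 - P) * u) + P * (1 - ((1 - α : ℝ) : ℂ) • u) =
        (α : ℂ) • 1 - (P - (α : ℂ) • 1) * v := by
      rw [hv]
      simp only [sub_mul, mul_sub, one_mul, mul_one, smul_mul_assoc, mul_smul_comm]
      push_cast
      module
    rw [this, Ring.mul_inverse_cancel _ hu]
  have hcomm : (1 - P) * ι (Ring.inverse h) = ι (Ring.inverse h) * (1 - P) := by
    rw [sub_mul, mul_sub, hS.comm, one_mul, mul_one]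
  -- The `(1 - P)`-row of `N Z P = P` is `α h⁻¹ (1 - P) Z P = 0`, because `P` commutes with `h⁻¹`;
  -- multiply by `h`.
  have h1 : (1 - P) * (Z * P) = 0 := by
    have e1 : (1 - P) * (((α : ℂ) • ((1 - P) * ι (Ring.inverse h)) +
        P * (X - (α : ℂ) • ι β)) * Z) * P = 0 := by
      rw [hN, mul_one, sub_mul, one_mul, hPP, sub_self]
    have e2 : (1 - P) * P = 0 := by rw [sub_mul, one_mul, hPP, sub_self]
    have e3 : (1 - P) * (1 - P) = 1 - P := by rw [mul_sub, e2, sub_zero, mul_one]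
    have e4 : (α : ℂ) • (ι (Ring.inverse h) * ((1 - P) * (Z * P))) = 0 := by
      have e5 : (1 - P) * ((1 - P) * ι (Ring.inverse h) * Z) * P =
          ι (Ring.inverse h) * ((1 - P) * (Z * P)) := by
        calc _ = (1 - P) * (1 - P) * ι (Ring.inverse h) * Z * P := by simp only [mul_assoc]
          _ = _ := by rw [e3, hcomm]; simp only [mul_assoc]
      rw [← e1, add_mul, mul_add, mul_assoc P, ← mul_assoc (1 - P) P, e2, zero_mul, add_zero,
        smul_mul_assoc, mul_smul_comm, smul_mul_assoc, e5]
    have e5 : ι h * (ι (Ring.inverse h) * ((1 - P) * (Z * P))) = 0 := by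
      rw [(smul_eq_zero_iff_right hα).1 e4, mul_zero]
    rwa [← mul_assoc, ← map_mul, Ring.mul_inverse_cancel _ hhu, map_one, one_mul] at e5
  have h2 : Z * P = P * (Z * P) := by
    rwa [sub_mul, one_mul, sub_eq_zero] at h1
  -- This is the `P`-row of the same equation.
  have h3 : P * (X - (α : ℂ) • ι β) * (Z * P) = P := by
    have e1 : P * (((α : ℂ) • ((1 - P) * ι (Ring.inverse h)) +
        P * (X - (α : ℂ) • ι β)) * Z) * P = P := by
      rw [hN, mul_one, hPP]
    have e2 : P * (1 - P) = 0 := by rw [mul_sub, mul_one, hPP, sub_self]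
    rwa [add_mul, mul_add, smul_mul_assoc, mul_smul_comm, mul_assoc (1 - P), ← mul_assoc P (1 - P),
      e2, zero_mul, smul_zero, zero_add, ← mul_assoc P, ← mul_assoc P, hPP, mul_assoc] at e1
  have h4 : cornerShift ι P α X β * (Z * P) = (α : ℂ)⁻¹ • P := by
    have e : cornerShift ι P α X β * P = (α : ℂ)⁻¹ • (P * (X - (α : ℂ) • ι β) * P) := by
      rw [cornerShift, sub_mul, sub_mul, smul_mul_assoc, smul_mul_assoc, sub_mul 1 P, one_mul, hPP,
        sub_self, smul_zero, sub_zero, mul_assoc _ P P, hPP, mul_assoc _ P P, hPP, mul_sub, sub_mul,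
        smul_sub, mul_smul_comm, smul_mul_assoc, inv_smul_smul₀ hα, hS.comm, mul_assoc _ P P, hPP]
    rw [h2, ← mul_assoc, e, smul_mul_assoc, mul_assoc _ P, ← h2, h3]
  have h5 := congrArg (Ring.inverse (cornerShift ι P α X β) * ·) h4
  simp only [← mul_assoc, Ring.inverse_mul_cancel _ (hS.isUnit_cornerShift hX hβ), one_mul,
    mul_smul_comm] at h5
  rw [h5, cornerResolvent]

theorem inverse_mul_proj {v : 𝔐} (hu : IsUnit ((α : ℂ) • 1 - (P - (α : ℂ) • 1) * v)) :
    Ring.inverse ((α : ℂ) • 1 - (P - (α : ℂ) • 1) * v) * P =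
      1 + Ring.inverse ((α : ℂ) • 1 - (P - (α : ℂ) • 1) * v) * (P - (α : ℂ) • 1) * (1 + v) := by
  have h : P = ((α : ℂ) • 1 - (P - (α : ℂ) • 1) * v) + (P - (α : ℂ) • 1) * (1 + v) := by
    rw [mul_add, mul_one]; abel
  have h' := congrArg (Ring.inverse ((α : ℂ) • 1 - (P - (α : ℂ) • 1) * v) * ·) h
  rwa [mul_add (Ring.inverse _), Ring.inverse_mul_cancel _ hu, ← mul_assoc] at h'

/-! #### Alternating series -/

theorem ringInverse_eq {A : Type*} [Ring A] {a b : A} (h : a * b = 1) (h' : b * a = 1) :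
    Ring.inverse a = b :=
  Ring.inverse_unit (⟨a, b, h, h'⟩ : Aˣ)

theorem pow_mul_mem (hS : IsCompressionSetting ι τ E P α C 𝒬) {v : 𝔐} (hv : v ∈ C)
    (hEv : E v = 0) (k : ℕ) :
    ((α : ℂ)⁻¹ • ((P - (α : ℂ) • 1) * v)) ^ k * (P - (α : ℂ) • 1) ∈ 𝒬 := by
  induction k with
  | zero => simpa using hS.sub_mem
  | succ k ih =>
    rw [pow_succ', mul_assoc, smul_mul_assoc]
    exact 𝒬.smul_mem _ (hS.mul_mem _ ih v hv hEv)

/-- The Neumann series expands the element into alternating words `Q v Q v ⋯ Q`, with `Q = P - α`,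
and `𝒬` is closed. -/
theorem inverse_mul_mem (hS : IsCompressionSetting ι τ E P α C 𝒬) {v : 𝔐} (hv : v ∈ C)
    (hEv : E v = 0) (hn : ‖(α : ℂ)⁻¹ • ((P - (α : ℂ) • 1) * v)‖ < 1) :
    Ring.inverse ((α : ℂ) • 1 - (P - (α : ℂ) • 1) * v) * (P - (α : ℂ) • 1) ∈ 𝒬 := by
  have hα : (α : ℂ) ≠ 0 := Complex.ofReal_ne_zero.2 hS.pos.ne'
  set t := (α : ℂ)⁻¹ • ((P - (α : ℂ) • 1) * v) with ht
  set s := ∑' k : ℕ, t ^ k with hs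
  have hsum : HasSum (fun k : ℕ => t ^ k) s := (summable_geometric_of_norm_lt_one hn).hasSum
  have e1 : (α : ℂ) • 1 - (P - (α : ℂ) • 1) * v = (α : ℂ) • (1 - t) := by
    rw [smul_sub, ht, smul_inv_smul₀ hα]
  have hl : (1 - t) * s = 1 := mul_neg_geom_series t hn
  have hr : s * (1 - t) = 1 := geom_series_mul_neg t hn
  have e2 : Ring.inverse ((α : ℂ) • 1 - (P - (α : ℂ) • 1) * v) = (α : ℂ)⁻¹ • s := by
    rw [e1]
    exact ringInverse_eq (by
      rw [smul_mul_smul_comm, mul_inv_cancel₀ hα, hl, one_smul]) (by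
      rw [smul_mul_smul_comm, inv_mul_cancel₀ hα, hr, one_smul])
  rw [e2, smul_mul_assoc]
  refine 𝒬.smul_mem _ ?_
  exact hS.isClosed_submodule.mem_of_tendsto ((hsum.mul_right _).tendsto_sum_nat)
    (Filter.Eventually.of_forall fun N => 𝒬.sum_mem fun k _ => hS.pow_mul_mem hv hEv k)

theorem inverse_sub_mem_of_norm_lt_one {A : Type*} [NormedRing A] [NormedAlgebra ℂ A]
    [CompleteSpace A] {C : Subalgebra ℂ A} (hC : IsClosed (C : Set A)) {t : A} (ht : t ∈ C)
    (hn : ‖t‖ < 1) : Ring.inverse (1 - t) ∈ C := by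
  have hsum : HasSum (fun k : ℕ => t ^ k) (∑' k : ℕ, t ^ k) :=
    (summable_geometric_of_norm_lt_one hn).hasSum
  rw [ringInverse_eq (mul_neg_geom_series t hn)
    (geom_series_mul_neg t hn)]
  exact hC.mem_of_tendsto hsum.tendsto_sum_nat
    (Filter.Eventually.of_forall fun N => C.sum_mem fun k _ => C.pow_mem ht k)

/-- The defect of the linearization at `0` in the equation for `E v`. -/
noncomputable def defect (P : 𝔐) (α : ℝ) (v v₀ : 𝔐) : 𝔐 →L[ℂ] 𝔐 :=
  ContinuousLinearMap.mulLeftRight ℂ 𝔐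
    ((1 + v) * (Ring.inverse ((α : ℂ) • 1 - (P - (α : ℂ) • 1) * v) * (P - (α : ℂ) • 1)))
    (Ring.inverse ((α : ℂ) • 1 - (P - (α : ℂ) • 1) * v₀) * (P - (α : ℂ) • 1) * (1 + v)) -
  ContinuousLinearMap.mulLeftRight ℂ 𝔐
    ((α : ℂ)⁻¹ • (P - (α : ℂ) • 1)) ((α : ℂ)⁻¹ • (P - (α : ℂ) • 1))

/-- Since `P - α` commutes with the coefficients, only its variance `α - α²` appears. -/
theorem condExp_conj_sub (hS : IsCompressionSetting ι τ E P α C 𝒬) (e b : 𝔅) :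
    τ ((P - (α : ℂ) • 1) * ι e * (P - (α : ℂ) • 1) * ι b) =
      ((α : ℂ) - (α : ℂ) ^ 2) * τ (ι e * ι b) := by
  have hPP : P * P = P := hS.isStarProjection.isIdempotentElem
  have h1 : (P - (α : ℂ) • 1) * ι e * (P - (α : ℂ) • 1) * ι b =
      (1 - 2 * (α : ℂ)) • (P * ι (e * b)) + ((α : ℂ) ^ 2) • ι (e * b) := by
    have h2 : (P - (α : ℂ) • 1) * ι e = ι e * (P - (α : ℂ) • 1) := by
      simp [sub_mul, mul_sub, hS.comm]
    have h3 : (P - (α : ℂ) • 1) * (P - (α : ℂ) • 1) = (1 - 2 * (α : ℂ)) • P + ((α : ℂ) ^ 2) • 1 := by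
      simp only [sub_mul, mul_sub, hPP, smul_mul_assoc, mul_smul_comm, one_mul, mul_one]
      module
    rw [h2, mul_assoc (ι e), h3, map_mul]
    simp only [mul_add, add_mul, mul_smul_comm, smul_mul_assoc, mul_one, ← mul_assoc, hS.comm]
  rw [h1, map_add, map_smul, map_smul, hS.indep, map_mul, smul_eq_mul, smul_eq_mul]
  ring

theorem trace_comp_comm (hS : IsCompressionSetting ι τ E P α C 𝒬) (a b : 𝔅) :
    τ (ι (a * b)) = τ (ι (b * a)) := by
  rw [map_mul, hS.trace, ← map_mul]

/-- Set `e = E v`, `v₀ = v - e`, `Q = P - α`, and let `A`, `A₀` be the inverses of `α - Q v`, `α - Q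
v₀`. The definition of `h` gives `E(v + (1 + v) A Q (1 + v)) = 0`, and freeness gives `E((1 + v) A₀
Q (1 + v)) = 0` because `v₀` is centered. Subtracting, `e + E((1 + v) A Q e A₀ Q (1 + v)) = 0`.
Replacing the sandwich by its value `α⁻² Q e Q` at `v = v₀ = 0` contributes `(α⁻¹ - 1) e`, so `α⁻¹ e
= -E(defect e)`, which forces `e = 0` once the defect is small. -/
theorem condExp_eq_zero_of_small (hS : IsCompressionSetting ι τ E P α C 𝒬) {X : 𝔐}
    (hX : IsSelfAdjoint X) {β : 𝔅} (hβ : β ∈ upperHalfPlane 𝔅) {v : 𝔐}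
    (hv : v = ι (Ring.inverse (cornerCauchy ι E P α X β)) * subordinateResolvent ι E P α X β - 1)
    (hvC : v ∈ C)
    (hu : IsUnit ((α : ℂ) • 1 - (P - (α : ℂ) • 1) * v))
    (hu₀ : IsUnit ((α : ℂ) • 1 - (P - (α : ℂ) • 1) * (v - ι (E v))))
    (hn : ‖(α : ℂ)⁻¹ • ((P - (α : ℂ) • 1) * (v - ι (E v)))‖ < 1)
    (hd : α * ‖E‖ * ‖defect P α v (v - ι (E v))‖ < 1) : E v = 0 := by
  have hα : (α : ℂ) ≠ 0 := Complex.ofReal_ne_zero.2 hS.pos.ne'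
  have hR := hS.inv_smul_cornerResolvent_eq hX hβ hv hu
  rw [mul_assoc, inverse_mul_proj hu] at hR
  have hhu := hS.isUnit_cornerCauchy hX hβ
  set e := E v with he
  set v₀ := v - ι e with hv₀
  set Q := P - (α : ℂ) • 1 with hQ
  set A := Ring.inverse ((α : ℂ) • 1 - Q * v) with hA
  set A₀ := Ring.inverse ((α : ℂ) • 1 - Q * v₀) with hA₀
  set h := cornerCauchy ι E P α X β with hh
  set S := subordinateResolvent ι E P α X β with hSdef
  have hιS : ι (Ring.inverse h) * S = 1 + v := by rw [hv]; abel
  have hEι (b : 𝔅) : E (ι b) = b := hS.condExp_eq fun _ => rfl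
  have hv₀C : v₀ ∈ C := C.sub_mem hvC (hS.range_le e)
  have hEv₀ : E v₀ = 0 := by rw [hv₀, map_sub, hEι, he, sub_self]
  have hW₀ := hS.inverse_mul_mem hv₀C hEv₀ hn
  -- Resolvent identity: the elements inverted by `A` and `A₀` differ by `Q e`.
  have hAA : A * Q - A₀ * Q = A * Q * ι e * (A₀ * Q) := by
    have : A - A₀ = A * (Q * ι e) * A₀ := by
      have e1 : Q * ι e = ((α : ℂ) • 1 - Q * v₀) - ((α : ℂ) • 1 - Q * v) := by
        rw [hv₀, mul_sub]; abel
      rw [e1, mul_sub, sub_mul, mul_assoc A, hA₀, Ring.mul_inverse_cancel _ hu₀, mul_one, hA,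
        Ring.inverse_mul_cancel _ hu, one_mul]
    rw [← sub_mul, this]; simp only [mul_assoc]
  have h1 (b : 𝔅) : τ ((v + (1 + v) * (A * Q) * (1 + v)) * ι b) = 0 := by
    have e1 : τ ((1 + v) * (1 + A * Q * (1 + v)) * ι b) = τ (ι b) := by
      have e0 : (1 + v) * (1 + A * Q * (1 + v)) =
          ι (Ring.inverse h) * ((α : ℂ)⁻¹ • cornerResolvent ι P α X β) := by
        rw [hR, ← mul_assoc, hιS]
      rw [e0, mul_assoc, hS.trace, mul_assoc,
        ← map_mul, ← hS.condExp, map_smul]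
      change τ (ι h * _) = _
      rw [← map_mul, hS.trace_comp_comm, mul_assoc, Ring.inverse_mul_cancel _ hhu, mul_one]
    have e2 : (v + (1 + v) * (A * Q) * (1 + v)) * ι b =
        (1 + v) * (1 + A * Q * (1 + v)) * ι b - ι b := by
      simp only [mul_add, add_mul, one_mul, mul_one, mul_assoc]; abel
    rw [e2, map_sub, e1, sub_self]
  -- By traciality this pairs `A₀ Q`, which lies in `𝒬`, with `(1 + v) b (1 + v)`, which lies in
  -- `C`.
  have h2 (b : 𝔅) : τ ((1 + v) * (A₀ * Q) * (1 + v) * ι b) = 0 := by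
    rw [mul_assoc, mul_assoc, hS.trace, mul_assoc]
    exact hS.vanish _ hW₀ _ (C.mul_mem (C.mul_mem (C.add_mem C.one_mem hvC) (hS.range_le b))
      (C.add_mem C.one_mem hvC))
  have h3 : E (defect P α v v₀ (ι e)) = -((α : ℂ)⁻¹ • e) := by
    refine hS.condExp_eq fun b => ?_
    have e1 : defect P α v v₀ (ι e) * ι b =
        (v + (1 + v) * (A * Q) * (1 + v)) * ι b - (1 + v) * (A₀ * Q) * (1 + v) * ι b - v * ι b -
          ((α : ℂ)⁻¹ * (α : ℂ)⁻¹) • (Q * ι e * Q * ι b) := by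
      have e2 : (1 + v) * (A * Q) * ι e * (A₀ * Q * (1 + v)) =
          (1 + v) * (A * Q) * (1 + v) - (1 + v) * (A₀ * Q) * (1 + v) := by
        rw [← sub_mul, ← mul_sub, hAA]; simp only [mul_assoc]
      simp only [defect, sub_apply, ContinuousLinearMap.mulLeftRight_apply]
      rw [← hQ, ← hA, ← hA₀, e2]
      simp only [sub_mul, add_mul, smul_mul_assoc, mul_smul_comm, smul_smul]
      abel
    rw [e1, map_sub, map_sub, map_sub, h1, h2, map_smul, hS.condExp_conj_sub, ← hS.condExp v b,
      ← he, map_neg, map_smul, neg_mul, smul_mul_assoc, map_neg, map_smul, smul_eq_mul,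
      smul_eq_mul]
    field_simp
    ring
  have h4 : ‖e‖ ≤ α * ‖E‖ * ‖defect P α v v₀‖ * ‖e‖ := by
    have e1 : e = -((α : ℂ) • E (defect P α v v₀ (ι e))) := by
      rw [h3, smul_neg, smul_inv_smul₀ hα, neg_neg]
    calc ‖e‖ = α * ‖E (defect P α v v₀ (ι e))‖ := by
          conv_lhs => rw [e1]
          rw [norm_neg, norm_smul, Complex.norm_real, Real.norm_of_nonneg hS.pos.le]
      _ ≤ α * (‖E‖ * (‖defect P α v v₀‖ * ‖e‖)) := by
          have := hS.pos
          gcongr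
          refine (E.le_opNorm _).trans ?_
          gcongr
          refine (ContinuousLinearMap.le_opNorm _ _).trans ?_
          gcongr
          exact NonUnitalStarAlgHom.norm_apply_le ι e
      _ = _ := by ring
  by_contra hne
  have : 0 < ‖e‖ := norm_pos_iff.2 hne
  nlinarith

theorem trace_eq_of_condExp_eq_zero (hS : IsCompressionSetting ι τ E P α C 𝒬) {X : 𝔐}
    (hX : IsSelfAdjoint X) {β : 𝔅} (hβ : β ∈ upperHalfPlane 𝔅) {v : 𝔐}
    (hv : v = ι (Ring.inverse (cornerCauchy ι E P α X β)) * subordinateResolvent ι E P α X β - 1)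
    (hSC : subordinateResolvent ι E P α X β ∈ C) (hvC : v ∈ C)
    (hu : IsUnit ((α : ℂ) • 1 - (P - (α : ℂ) • 1) * v)) (hEv : E v = 0)
    (hn : ‖(α : ℂ)⁻¹ • ((P - (α : ℂ) • 1) * v)‖ < 1) {m : 𝔐} (hm : m ∈ C) :
    τ ((α : ℂ)⁻¹ • cornerResolvent ι P α X β * m) = τ (subordinateResolvent ι E P α X β * m) := by
  rw [hS.inv_smul_cornerResolvent_eq hX hβ hv hu, mul_assoc (subordinateResolvent ι E P α X β),
    inverse_mul_proj hu, mul_add, mul_one, add_mul, map_add, mul_assoc, hS.trace _ (_ * m),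
    mul_assoc _ (1 + v) m, mul_assoc, hS.vanish _ (hS.inverse_mul_mem hvC hEv hn) _
      (C.mul_mem (C.mul_mem (C.add_mem C.one_mem hvC) hm) hSC), add_zero]

end IsCompressionSetting
end Core
-- From small multiples of the variable to the variable itself
section Continuation

variable {𝔐 𝔅 : Type*} [CStarAlgebra 𝔐] [PartialOrder 𝔐] [StarOrderedRing 𝔐]
  [CStarAlgebra 𝔅] [PartialOrder 𝔅] [StarOrderedRing 𝔅]

namespace IsCompressionSetting

variable {ι : 𝔅 →⋆ₐ[ℂ] 𝔐} {τ : 𝔐 →L[ℂ] ℂ} {E : 𝔐 →L[ℂ] 𝔅} {P : 𝔐} {α : ℝ}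
  {C : Subalgebra ℂ 𝔐} {𝒬 : Submodule ℂ 𝔐}

open Filter Topology

/-! #### The unperturbed case -/

/-- At `X = 0` the corner resolvent is `-P β⁻¹`, and `E P = α`. This base point gives `v = 0`. -/
theorem cornerCauchy_zero (hS : IsCompressionSetting ι τ E P α C 𝒬) {β : 𝔅}
    (hβ : β ∈ upperHalfPlane 𝔅) : cornerCauchy ι E P α 0 β = -Ring.inverse β := by
  have hα : (α : ℂ) ≠ 0 := Complex.ofReal_ne_zero.2 hS.pos.ne'
  have hPP : P * P = P := hS.isStarProjection.isIdempotentElem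
  have hβu := isUnit_of_mem_upperHalfPlane hβ
  have h1 : cornerShift ι P α 0 β * -(P * ι (Ring.inverse β)) = P := by
    have : (1 - P) * (P * ι (Ring.inverse β)) = 0 := by
      rw [← mul_assoc, sub_mul, one_mul, hPP, sub_self, zero_mul]
    rw [cornerShift, mul_zero, zero_mul, smul_zero, zero_sub, sub_mul, smul_mul_assoc, mul_neg,
      mul_neg, this, neg_zero, smul_zero, sub_zero, neg_mul, neg_neg, mul_assoc, ← mul_assoc P,
      hPP, hS.comm, ← mul_assoc, ← map_mul, Ring.mul_inverse_cancel _ hβu, map_one, one_mul]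
  have h2 : cornerResolvent ι P α 0 β = -(P * ι (Ring.inverse β)) := by
    rw [cornerResolvent]
    nth_rewrite 2 [← h1]
    rw [← mul_assoc, Ring.inverse_mul_cancel _
      (hS.isUnit_cornerShift (IsSelfAdjoint.zero _) hβ), one_mul]
  have h3 : E (cornerResolvent ι P α 0 β) = -((α : ℂ) • Ring.inverse β) := by
    refine hS.condExp_eq fun b => ?_
    rw [h2, neg_mul, map_neg, mul_assoc, ← map_mul, hS.indep, map_neg, map_smul, neg_mul,
      smul_mul_assoc, map_neg, map_smul, smul_eq_mul, map_mul]
  rw [cornerCauchy, h3, smul_neg, inv_smul_smul₀ hα]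

theorem subordination_zero (hS : IsCompressionSetting ι τ E P α C 𝒬) {β : 𝔅}
    (hβ : β ∈ upperHalfPlane 𝔅) : subordination ι E P α 0 β = β := by
  have hβu := isUnit_of_mem_upperHalfPlane hβ
  have h : Ring.inverse (-Ring.inverse β) = -β := ringInverse_eq
    (by rw [neg_mul_neg, Ring.inverse_mul_cancel _ hβu])
    (by rw [neg_mul_neg, Ring.mul_inverse_cancel _ hβu])
  rw [subordination, hS.cornerCauchy_zero hβ, h, neg_neg, ← add_smul]
  simp

theorem subordinateResolvent_zero (hS : IsCompressionSetting ι τ E P α C 𝒬) {β : 𝔅}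
    (hβ : β ∈ upperHalfPlane 𝔅) : subordinateResolvent ι E P α 0 β = -ι (Ring.inverse β) := by
  have hβu := isUnit_of_mem_upperHalfPlane hβ
  rw [subordinateResolvent, hS.subordination_zero hβ, zero_sub]
  exact ringInverse_eq
    (by rw [neg_mul_neg, ← map_mul, Ring.mul_inverse_cancel _ hβu, map_one])
    (by rw [neg_mul_neg, ← map_mul, Ring.inverse_mul_cancel _ hβu, map_one])

/-! #### Small perturbations -/

theorem isUnit_of_norm_lt_one (hS : IsCompressionSetting ι τ E P α C 𝒬) {v : 𝔐}
    (hn : ‖(α : ℂ)⁻¹ • ((P - (α : ℂ) • 1) * v)‖ < 1) :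
    IsUnit ((α : ℂ) • 1 - (P - (α : ℂ) • 1) * v) := by
  have hα : (α : ℂ) ≠ 0 := Complex.ofReal_ne_zero.2 hS.pos.ne'
  have := (isUnit_one_sub_of_norm_lt_one hn).smul (Units.mk0 _ hα)
  rwa [Units.smul_mk0, smul_sub, smul_inv_smul₀ hα] at this

theorem continuousAt_inverse_sub (hS : IsCompressionSetting ι τ E P α C 𝒬) :
    ContinuousAt (fun v : 𝔐 => Ring.inverse ((α : ℂ) • 1 - (P - (α : ℂ) • 1) * v)) 0 := by
  obtain ⟨u, hu⟩ := hS.isUnit_of_norm_lt_one (v := 0) (by simp)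
  refine ContinuousAt.comp (g := Ring.inverse) ?_ (by fun_prop)
  rw [← hu]
  exact NormedRing.inverse_continuousAt u

/-- At `v = v₀ = 0` both inverses equal `α⁻¹`, so the two sandwich maps in `defect` coincide. -/
theorem tendsto_defect (hS : IsCompressionSetting ι τ E P α C 𝒬) :
    Tendsto (fun x : 𝔐 × 𝔐 => defect P α x.1 x.2) (𝓝 (0, 0)) (𝓝 0) := by
  have hα : (α : ℂ) ≠ 0 := Complex.ofReal_ne_zero.2 hS.pos.ne'
  have hinv : Ring.inverse ((α : ℂ) • (1 : 𝔐)) = (α : ℂ)⁻¹ • 1 := ringInverse_eq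
    (by rw [smul_mul_smul_comm, mul_inv_cancel₀ hα, one_smul, one_mul])
    (by rw [smul_mul_smul_comm, inv_mul_cancel₀ hα, one_smul, one_mul])
  have h1 : ContinuousAt (fun x : 𝔐 × 𝔐 =>
      Ring.inverse ((α : ℂ) • 1 - (P - (α : ℂ) • 1) * x.1)) (0, 0) :=
    ContinuousAt.comp (f := Prod.fst) (x := ((0 : 𝔐), (0 : 𝔐)))
      hS.continuousAt_inverse_sub continuousAt_fst
  have h2 : ContinuousAt (fun x : 𝔐 × 𝔐 =>
      Ring.inverse ((α : ℂ) • 1 - (P - (α : ℂ) • 1) * x.2)) (0, 0) :=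
    ContinuousAt.comp (f := Prod.snd) (x := ((0 : 𝔐), (0 : 𝔐)))
      hS.continuousAt_inverse_sub continuousAt_snd
  have h3 : ContinuousAt (fun x : 𝔐 × 𝔐 => defect P α x.1 x.2) (0, 0) := by
    unfold defect
    fun_prop
  have h4 : defect P α (0 : 𝔐) 0 = 0 := by
    rw [defect, mul_zero, sub_zero, hinv]
    simp
  have := h3.tendsto
  rwa [h4] at this

theorem eventually_trace_eq (hS : IsCompressionSetting ι τ E P α C 𝒬) {X : 𝔐}
    (hX : IsSelfAdjoint X) (hXC : X ∈ C) {β : 𝔅} (hβ : β ∈ upperHalfPlane 𝔅) {m : 𝔐}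
    (hm : m ∈ C) :
    ∀ᶠ z : ℝ in 𝓝 0, τ ((α : ℂ)⁻¹ • cornerResolvent ι P α (z • X) β * m) =
      τ (subordinateResolvent ι E P α (z • X) β * m) := by
  have hβu := isUnit_of_mem_upperHalfPlane hβ
  have hz : ContinuousAt (fun z : ℝ => (z • X, β)) 0 := by fun_prop
  have hz0 : ((0 : ℝ) • X, β) = ((0 : 𝔐), β) := by rw [zero_smul]
  have hX0 : IsSelfAdjoint (0 : 𝔐) := IsSelfAdjoint.zero _
  have hcomp {f : 𝔐 × 𝔅 → 𝔅} (hf : ContinuousAt f (0, β)) :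
      ContinuousAt (fun z : ℝ => f (z • X, β)) 0 :=
    ContinuousAt.comp (f := fun z : ℝ => (z • X, β)) (by rw [hz0]; exact hf) hz
  have hι : Continuous ι := map_continuous ι
  have hcF : ContinuousAt (fun z : ℝ => Ring.inverse (subordination ι E P α (z • X) β)) 0 :=
    hcomp (f := fun x => Ring.inverse (subordination ι E P α x.1 x.2))
      (analyticAt_ringInverse_comp (hS.analyticAt_subordination hX0 hβ)
        (isUnit_of_mem_upperHalfPlane (hS.subordination_mem hX0 hβ))).continuousAt
  have hch : ContinuousAt (fun z : ℝ => Ring.inverse (cornerCauchy ι E P α (z • X) β)) 0 :=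
    hcomp (f := fun x => Ring.inverse (cornerCauchy ι E P α x.1 x.2))
      (analyticAt_ringInverse_comp (hS.analyticAt_cornerCauchy hX0 hβ)
        (hS.isUnit_cornerCauchy hX0 hβ)).continuousAt
  have hcS : ContinuousAt (fun z : ℝ => subordinateResolvent ι E P α (z • X) β) 0 :=
    ContinuousAt.comp (f := fun z : ℝ => (z • X, β))
      (g := fun x => subordinateResolvent ι E P α x.1 x.2)
      (by rw [hz0]; exact (hS.analyticAt_subordinateResolvent hX0 hβ).continuousAt) hz
  set v : ℝ → 𝔐 := fun z => ι (Ring.inverse (cornerCauchy ι E P α (z • X) β)) *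
    subordinateResolvent ι E P α (z • X) β - 1 with hv
  have hv0 : v 0 = 0 := by
    have h : Ring.inverse (-Ring.inverse β) = -β := ringInverse_eq
      (by rw [neg_mul_neg, Ring.inverse_mul_cancel _ hβu])
      (by rw [neg_mul_neg, Ring.mul_inverse_cancel _ hβu])
    simp only [hv, zero_smul]
    rw [hS.cornerCauchy_zero hβ, hS.subordinateResolvent_zero hβ, h, map_neg, neg_mul_neg,
      ← map_mul, Ring.mul_inverse_cancel _ hβu, map_one, sub_self]
  have hcv : Tendsto v (𝓝 0) (𝓝 0) := by
    have : ContinuousAt v 0 := ((hι.continuousAt.comp hch).mul hcS).sub continuousAt_const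
    rw [ContinuousAt, hv0] at this
    exact this
  have hcv₀ : Tendsto (fun z => v z - ι (E (v z))) (𝓝 0) (𝓝 0) := by
    have : Tendsto (fun x : 𝔐 => x - ι (E x)) (𝓝 0) (𝓝 0) := by
      have h : Continuous (fun x : 𝔐 => x - ι (E x)) :=
        continuous_id.sub (hι.comp E.continuous)
      simpa using h.tendsto 0
    exact this.comp hcv
  have hsmall {w : ℝ → 𝔐} (hw : Tendsto w (𝓝 0) (𝓝 0)) :
      ∀ᶠ z in 𝓝 0, ‖(α : ℂ)⁻¹ • ((P - (α : ℂ) • 1) * w z)‖ < 1 := by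
    have h : Continuous (fun x : 𝔐 => ‖(α : ℂ)⁻¹ • ((P - (α : ℂ) • 1) * x)‖) := by fun_prop
    have h' := (h.tendsto 0).comp hw
    rw [mul_zero, smul_zero, norm_zero] at h'
    exact h'.eventually_lt_const one_pos
  have hdef : ∀ᶠ z in 𝓝 0, α * ‖E‖ * ‖defect P α (v z) (v z - ι (E (v z)))‖ < 1 := by
    have h := (hS.tendsto_defect.comp (hcv.prodMk_nhds hcv₀)).norm.const_mul (α * ‖E‖)
    rw [norm_zero, mul_zero] at h
    exact h.eventually_lt_const one_pos
  have hSmall : ∀ᶠ z in 𝓝 (0 : ℝ), ‖z • X * ι (Ring.inverse (subordination ι E P α (z • X) β))‖ < 1 := by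
    have h : ContinuousAt
        (fun z : ℝ => z • X * ι (Ring.inverse (subordination ι E P α (z • X) β))) 0 :=
      (continuousAt_id.smul continuousAt_const).mul (hι.continuousAt.comp hcF)
    have h' := h.tendsto.norm
    simp only [zero_smul, zero_mul, norm_zero] at h'
    exact h'.eventually_lt_const one_pos
  filter_upwards [hsmall hcv, hsmall hcv₀, hdef, hSmall] with z h1 h2 h3 h4
  have hzX : IsSelfAdjoint (z • X) := (IsSelfAdjoint.all z).smul hX
  have hzC : z • X ∈ C := by rw [← Complex.coe_smul]; exact C.smul_mem hXC _
  have hFu := isUnit_of_mem_upperHalfPlane (hS.subordination_mem hzX hβ)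
  -- A closed subalgebra need not contain inverses. For small `z` the factorization `z X - F = (1 -
  -- z X F⁻¹) (-F)` reduces the claim to a Neumann series in `C` and to `F⁻¹`, which is a
  -- coefficient.
  have hSC : subordinateResolvent ι E P α (z • X) β ∈ C := by
    set t := z • X * ι (Ring.inverse (subordination ι E P α (z • X) β)) with ht
    have hu := isUnit_one_sub_of_norm_lt_one h4
    have e1 : z • X - ι (subordination ι E P α (z • X) β) =
        (1 - t) * -ι (subordination ι E P α (z • X) β) := by
      rw [mul_neg, sub_mul, one_mul, ht, mul_assoc, ← map_mul, Ring.inverse_mul_cancel _ hFu,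
        map_one, mul_one]
      abel
    have e2 : subordinateResolvent ι E P α (z • X) β =
        -ι (Ring.inverse (subordination ι E P α (z • X) β)) * Ring.inverse (1 - t) := by
      rw [subordinateResolvent, e1, Ring.inverse_mul (Or.inl hu)]
      congr 1
      exact ringInverse_eq
        (by rw [neg_mul_neg, ← map_mul, Ring.mul_inverse_cancel _ hFu, map_one])
        (by rw [neg_mul_neg, ← map_mul, Ring.inverse_mul_cancel _ hFu, map_one])
    rw [e2]
    exact C.mul_mem (C.neg_mem (hS.range_le _)) (inverse_sub_mem_of_norm_lt_one
      hS.isClosed_subalgebra (C.mul_mem hzC (hS.range_le _)) h4)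
  have hvC : v z ∈ C := C.sub_mem (C.mul_mem (hS.range_le _) hSC) C.one_mem
  have hEv : E (v z) = 0 := hS.condExp_eq_zero_of_small hzX hβ rfl hvC
    (hS.isUnit_of_norm_lt_one h1) (hS.isUnit_of_norm_lt_one h2) h2 h3
  exact hS.trace_eq_of_condExp_eq_zero hzX hβ rfl hSC hvC (hS.isUnit_of_norm_lt_one h1) hEv h1 hm

/-! #### Analytic continuation -/

theorem trace_cornerResolvent_eq (hS : IsCompressionSetting ι τ E P α C 𝒬) {X : 𝔐}
    (hX : IsSelfAdjoint X) (hXC : X ∈ C) {β : 𝔅} (hβ : β ∈ upperHalfPlane 𝔅) {m : 𝔐}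
    (hm : m ∈ C) :
    τ ((α : ℂ)⁻¹ • cornerResolvent ι P α X β * m) = τ (subordinateResolvent ι E P α X β * m) := by
  set f : 𝔐 × 𝔅 → ℂ := fun x => τ ((α : ℂ)⁻¹ • cornerResolvent ι P α x.1 x.2 * m) -
    τ (subordinateResolvent ι E P α x.1 x.2 * m) with hf
  -- Only real `z` keep `z X` self-adjoint, so the continuation runs along the real line.
  have hfan : AnalyticOnNhd ℝ (fun z : ℝ => f (z • X, β)) Set.univ := by
    intro z _
    have hzX : IsSelfAdjoint (z • X) := (IsSelfAdjoint.all z).smul hX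
    have h1 : AnalyticAt ℂ f (z • X, β) :=
      ((τ.analyticAt _).comp (((hS.analyticAt_cornerResolvent hzX hβ).const_smul
        (c := (α : ℂ)⁻¹)).mul analyticAt_const)).sub
      ((τ.analyticAt _).comp ((hS.analyticAt_subordinateResolvent hzX hβ).mul analyticAt_const))
    have h2 : AnalyticAt ℝ (fun z : ℝ => (z • X, β)) z :=
      (((ContinuousLinearMap.id ℝ ℝ).smulRight X).analyticAt z).prod analyticAt_const
    exact (h1.restrictScalars (𝕜 := ℝ)).comp_of_eq h2 rfl
  have h0 := hfan.eqOn_zero_of_preconnected_of_eventuallyEq_zero isPreconnected_univ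
    (Set.mem_univ (0 : ℝ)) (by
      filter_upwards [hS.eventually_trace_eq hX hXC hβ hm] with z hz
      exact sub_eq_zero.2 hz)
  have h1 := h0 (Set.mem_univ (1 : ℝ))
  simp only [one_smul] at h1
  exact sub_eq_zero.1 h1

end IsCompressionSetting
end Continuation
/-! ### Amplification to `ℓ²(ℕ, H)` -/

section Amplification

open Filter Topology

variable {H : Type*} [NormedAddCommGroup H] [InnerProductSpace ℂ H] [CompleteSpace H]

theorem memℓp_map (a : H →L[ℂ] H) (f : lp (fun _ : ℕ => H) 2) :
    Memℓp (fun k => a (f k)) 2 := by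
  have h2 : 0 < (2 : ENNReal).toReal := by simp
  have hf := (memℓp_gen_iff h2).1 (lp.memℓp f)
  refine (memℓp_gen_iff h2).2 ((hf.mul_left (‖a‖ ^ (2 : ENNReal).toReal)).of_nonneg_of_le
    (fun k => by positivity) fun k => ?_)
  rw [← Real.mul_rpow (norm_nonneg _) (norm_nonneg _)]
  gcongr
  exact a.le_opNorm _

/-- The operator `a ⊗ 1` on `ℓ²(ℕ, H)`. -/
noncomputable def diagMap (a : H →L[ℂ] H) : lp (fun _ : ℕ => H) 2 →L[ℂ] lp (fun _ : ℕ => H) 2 :=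
  LinearMap.mkContinuous
    { toFun := fun f => ⟨fun k => a (f k), memℓp_map a f⟩
      map_add' := fun f g => by ext k; exact map_add a (f k) (g k)
      map_smul' := fun c f => by ext k; simp } ‖a‖ fun f => by
    have h2 : 0 < (2 : ENNReal).toReal := by simp
    have hf := (memℓp_gen_iff h2).1 (lp.memℓp f)
    refine lp.norm_le_of_tsum_le h2 (by positivity) ?_
    rw [Real.mul_rpow (norm_nonneg _) (norm_nonneg _), lp.norm_rpow_eq_tsum h2, ← tsum_mul_left]
    refine Summable.tsum_le_tsum (fun k => ?_) ((memℓp_gen_iff h2).1 (memℓp_map a f))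
      (hf.mul_left _)
    rw [← Real.mul_rpow (norm_nonneg _) (norm_nonneg _)]
    change ‖a (f k)‖ ^ _ ≤ _
    gcongr
    exact a.le_opNorm _

@[simp]
theorem diagMap_apply (a : H →L[ℂ] H) (f : lp (fun _ : ℕ => H) 2) (k : ℕ) :
    diagMap a f k = a (f k) := rfl

/-- The orbit map `a ↦ (a ⊗ 1) Ξ`. -/
noncomputable def orbit (Ξ : lp (fun _ : ℕ => H) 2) :
    (H →L[ℂ] H) →ₗ[ℂ] lp (fun _ : ℕ => H) 2 where
  toFun a := diagMap a Ξ
  map_add' a b := by ext k; simp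
  map_smul' c a := by ext k; simp

@[simp]
theorem orbit_apply (Ξ : lp (fun _ : ℕ => H) 2) (a : H →L[ℂ] H) (k : ℕ) :
    orbit Ξ a k = a (Ξ k) := rfl

theorem diagMap_orbit (Ξ : lp (fun _ : ℕ => H) 2) (a b : H →L[ℂ] H) :
    diagMap a (orbit Ξ b) = orbit Ξ (a * b) := by ext k; simp

theorem inner_diagMap (a : H →L[ℂ] H) (f g : lp (fun _ : ℕ => H) 2) :
    ⟪f, diagMap a g⟫_ℂ = ⟪diagMap (star a) f, g⟫_ℂ := by
  rw [lp.inner_eq_tsum, lp.inner_eq_tsum]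
  congr 1; ext k
  simp [ContinuousLinearMap.star_eq_adjoint, ContinuousLinearMap.adjoint_inner_left]

theorem diagMap_single (a : H →L[ℂ] H) (j : ℕ) (x : H) :
    diagMap a (lp.single 2 j x) = lp.single 2 j (a x) := by
  ext k
  by_cases h : k = j
  · subst h; simp
  · simp [h]

/-- The orbit of a vector under the double commutant of a `⋆`-algebra lies in the closure of its
orbit under the algebra. -/
theorem orbit_mem_closure (A : StarSubalgebra ℂ (H →L[ℂ] H)) (Ξ : lp (fun _ : ℕ => H) 2)
    {a : H →L[ℂ] H} (ha : a ∈ Set.centralizer (Set.centralizer (A : Set (H →L[ℂ] H)))) :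
    orbit Ξ a ∈ (A.toSubalgebra.toSubmodule.map (orbit Ξ)).topologicalClosure := by
  set V := (A.toSubalgebra.toSubmodule.map (orbit Ξ)).topologicalClosure with hV
  have hVc : IsClosed (V : Set (lp (fun _ : ℕ => H) 2)) :=
    Submodule.isClosed_topologicalClosure _
  have : CompleteSpace V := hVc.completeSpace_coe
  have hinv (d : H →L[ℂ] H) (hd : d ∈ A) (f : lp (fun _ : ℕ => H) 2) (hf : f ∈ V) :
      diagMap d f ∈ V := by
    refine map_mem_closure (diagMap d).continuous hf ?_
    rintro _ ⟨b, hb, rfl⟩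
    exact ⟨d * b, A.mul_mem hd hb, (diagMap_orbit Ξ d b).symm⟩
  have hcomm (d : H →L[ℂ] H) (hd : d ∈ A) (f : lp (fun _ : ℕ => H) 2) :
      V.starProjection (diagMap d f) = diagMap d (V.starProjection f) := by
    refine Submodule.eq_starProjection_of_mem_orthogonal
      (hinv d hd _ (V.starProjection_apply_mem f)) ?_
    rw [← map_sub, Submodule.mem_orthogonal]
    intro w hw
    rw [inner_diagMap]
    exact (Submodule.mem_orthogonal _ _).1 (V.sub_starProjection_mem_orthogonal f) _
      (hinv _ (star_mem hd) w hw)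
  -- The projection onto `V` commutes with `d ⊗ 1` for every `d ∈ A`, so its operator matrix entries
  -- lie in the commutant of `A`. An element `a` of the double commutant commutes with them, hence
  -- `a ⊗ 1` commutes with the projection.
  have hent (i j : ℕ) : (lp.evalCLM ℂ (fun _ : ℕ => H) 2 i).comp (V.starProjection.comp
      (lp.singleContinuousLinearMap ℂ (fun _ : ℕ => H) 2 j)) ∈
        Set.centralizer (A : Set (H →L[ℂ] H)) := by
    intro d hd
    ext x
    change d (V.starProjection (lp.single 2 j x) i) = V.starProjection (lp.single 2 j (d x)) i
    rw [← diagMap_single, hcomm d hd, diagMap_apply]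
  have hfin : V.starProjection.comp (diagMap a) = (diagMap a).comp V.starProjection := by
    refine lp.ext_continuousLinearMap (by simp) fun j => ?_
    ext x i
    have h := congrArg (fun T : H →L[ℂ] H => T x) (ha _ (hent i j))
    change V.starProjection (lp.single 2 j (a x)) i = a (V.starProjection (lp.single 2 j x) i) at h
    change V.starProjection (diagMap a (lp.single 2 j x)) i = _
    rw [diagMap_single]
    exact h
  have hΞ : Ξ ∈ V := Submodule.le_topologicalClosure _
    ⟨1, A.one_mem, by ext k; simp⟩
  have h1 := congrArg (fun T => T Ξ) hfin
  simp only [ContinuousLinearMap.comp_apply, (Submodule.starProjection_eq_self_iff).2 hΞ] at h1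
  change diagMap a Ξ ∈ V
  rw [← h1]
  exact V.starProjection_apply_mem _

/-! ### Strong limits of bounded sequences -/

/-- The uniform bound gives equicontinuity, so the Cauchy property spreads from a total set to all
of `H` by an `ε/3` argument. -/
theorem exists_strong_limit {b : ℕ → H →L[ℂ] H} {r : ℝ} (hb : ∀ k, ‖b k‖ ≤ r) {T : Set H}
    (hT : Dense (Submodule.span ℂ T : Set H)) (hc : ∀ x ∈ T, CauchySeq fun k => b k x) :
    ∃ a : H →L[ℂ] H, ‖a‖ ≤ r ∧ ∀ x, Tendsto (fun k => b k x) atTop (𝓝 (a x)) := by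
  have hr : 0 ≤ r := (norm_nonneg _).trans (hb 0)
  have hspan : ∀ x ∈ Submodule.span ℂ T, CauchySeq fun k => b k x := by
    intro x hx
    induction hx using Submodule.span_induction with
    | mem x hx => exact hc x hx
    | zero => simpa using cauchySeq_const (0 : H)
    | add x y _ _ hx hy => simpa [Pi.add_def] using hx.add hy
    | smul c x _ hx =>
      simp only [map_smul]
      exact (uniformContinuous_const_smul c).comp_cauchySeq hx
  have hall : ∀ x, CauchySeq fun k => b k x := by
    intro x
    rw [Metric.cauchySeq_iff']
    intro ε hε
    obtain ⟨y, hy, hxy⟩ := Metric.dense_iff.1 hT x (ε / (3 * (r + 1))) (by positivity)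
    obtain ⟨N, hN⟩ := Metric.cauchySeq_iff'.1 (hspan y hxy) (ε / 3) (by positivity)
    have hd : ∀ k, dist (b k x) (b k y) < ε / 3 := fun k => by
      rw [dist_eq_norm, ← map_sub]
      have hyx : ‖x - y‖ < ε / (3 * (r + 1)) := by
        rw [← dist_eq_norm, dist_comm]; exact hy
      calc ‖b k (x - y)‖ ≤ r * ‖x - y‖ := (b k).le_of_opNorm_le (hb k) _
        _ ≤ (r + 1) * ‖x - y‖ := by gcongr; linarith
        _ < (r + 1) * (ε / (3 * (r + 1))) := by gcongr
        _ = ε / 3 := by field_simp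
    refine ⟨N, fun n hn => ?_⟩
    calc dist (b n x) (b N x) ≤ dist (b n x) (b n y) + dist (b n y) (b N y) + dist (b N y) (b N x) :=
          dist_triangle4 _ _ _ _
      _ < ε / 3 + ε / 3 + ε / 3 := by
          gcongr
          · exact hd n
          · exact hN n hn
          · rw [dist_comm]; exact hd N
      _ = ε := by ring
  choose f hf using fun x => cauchySeq_tendsto_of_complete (hall x)
  refine ⟨continuousLinearMapOfTendsto b (tendsto_pi_nhds.2 hf), ?_, hf⟩
  refine ContinuousLinearMap.opNorm_le_bound _ hr fun x => ?_
  exact le_of_tendsto (hf x).norm (Eventually.of_forall fun k => (b k).le_of_opNorm_le (hb k) x)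

/-- If `M` separates from `0` on the coordinates of `Ξ`, its commutant applied to them is total. -/
theorem dense_span_commutant (M : VonNeumannAlgebra H) {ξ : ℕ → H}
    (hsep : ∀ a ∈ M, (∀ k, a (ξ k) = 0) → a = 0) :
    Dense (Submodule.span ℂ {x | ∃ c ∈ M.commutant, ∃ k, x = c (ξ k)} : Set H) := by
  set V := (Submodule.span ℂ {x | ∃ c ∈ M.commutant, ∃ k, x = c (ξ k)}).topologicalClosure with hV
  have hVc : IsClosed (V : Set H) := Submodule.isClosed_topologicalClosure _
  have : CompleteSpace V := hVc.completeSpace_coe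
  have hinv (d : H →L[ℂ] H) (hd : d ∈ M.commutant) (f : H) (hf : f ∈ V) : d f ∈ V := by
    refine map_mem_closure d.continuous hf fun x hx => ?_
    induction hx using Submodule.span_induction with
    | mem x hx =>
      obtain ⟨c, hc, k, rfl⟩ := hx
      exact Submodule.subset_span ⟨d * c, mul_mem hd hc, k, rfl⟩
    | zero => simp
    | add x y _ _ hx hy => rw [map_add]; exact Submodule.add_mem _ hx hy
    | smul c x _ hx => rw [map_smul]; exact Submodule.smul_mem _ c hx
  have hcomm (d : H →L[ℂ] H) (hd : d ∈ M.commutant) (f : H) :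
      V.starProjection (d f) = d (V.starProjection f) := by
    refine Submodule.eq_starProjection_of_mem_orthogonal
      (hinv d hd _ (V.starProjection_apply_mem f)) ?_
    rw [← map_sub, Submodule.mem_orthogonal]
    intro w hw
    rw [← ContinuousLinearMap.adjoint_inner_left]
    exact (Submodule.mem_orthogonal _ _).1 (V.sub_starProjection_mem_orthogonal f) _
      (hinv _ (star_mem hd) w hw)
  -- `V` is invariant under the commutant, so its projection lies in the bicommutant `M`; its
  -- complement then kills every `ξ k` and vanishes by separation.
  have hPM : V.starProjection ∈ M := by
    rw [← M.commutant_commutant, VonNeumannAlgebra.mem_commutant_iff]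
    intro d hd
    ext x
    exact (hcomm d hd x).symm
  have h0 : (1 : H →L[ℂ] H) - V.starProjection = 0 := by
    refine hsep _ (sub_mem (one_mem M) hPM) fun k => ?_
    have : ξ k ∈ V := Submodule.le_topologicalClosure _
      (Submodule.subset_span ⟨1, one_mem _, k, by simp⟩)
    simp [(Submodule.starProjection_eq_self_iff).2 this]
  rw [dense_iff_closure_eq, Set.eq_univ_iff_forall]
  intro x
  have hx : V.starProjection x = x := by
    rw [← sub_eq_zero.1 h0]; rfl
  change x ∈ V
  rw [← hx]
  exact V.starProjection_apply_mem x

/-- Balls of a von Neumann subalgebra have closed orbits in `ℓ²(ℕ, H)`. -/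
theorem isClosed_orbit_ball {M B : VonNeumannAlgebra H} (hBM : B ≤ M)
    (Ξ : lp (fun _ : ℕ => H) 2) (hsep : ∀ a ∈ M, (∀ k, a (Ξ k) = 0) → a = 0) (r : ℝ) :
    IsClosed (orbit Ξ '' {b | b ∈ B ∧ ‖b‖ ≤ r}) := by
  rw [← isSeqClosed_iff_isClosed]
  intro x η hx hη
  choose b hb hbx using hx
  have hcoord (k : ℕ) : Tendsto (fun n => b n (Ξ k)) atTop (𝓝 (η k)) := by
    have := ((lp.evalCLM ℂ (fun _ : ℕ => H) 2 k).continuous.tendsto η).comp hη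
    refine this.congr fun n => ?_
    change x n k = _
    rw [← hbx n, orbit_apply]
  -- On the total set of vectors `c (ξ k)` with `c` in the commutant, `b n (c (ξ k)) = c (b n (ξ
  -- k))` converges.
  obtain ⟨a, har, ha⟩ := exists_strong_limit (fun n => (hb n).2) (dense_span_commutant M hsep) (by
    rintro _ ⟨c, hc, k, rfl⟩
    have : Tendsto (fun n => c (b n (Ξ k))) atTop (𝓝 (c (η k))) :=
      (c.continuous.tendsto _).comp (hcoord k)
    refine (this.congr fun n => ?_).cauchySeq
    have := VonNeumannAlgebra.mem_commutant_iff.1 hc (b n) (hBM (hb n).1)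
    exact (congrArg (fun T : H →L[ℂ] H => T (Ξ k)) this).symm)
  refine ⟨a, ⟨?_, har⟩, ?_⟩
  · rw [← B.commutant_commutant, VonNeumannAlgebra.mem_commutant_iff]
    intro c hc
    ext y
    refine tendsto_nhds_unique ((c.continuous.tendsto _).comp (ha y)) ((ha (c y)).congr fun n => ?_)
    have := VonNeumannAlgebra.mem_commutant_iff.1 hc (b n) (hb n).1
    exact congrArg (fun T : H →L[ℂ] H => T y) this
  · ext k
    exact tendsto_nhds_unique (ha (Ξ k)) (hcoord k)

end Amplification

/-! ### Trace estimates -/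

section Polar

variable {𝔐 𝔅 : Type*} [CStarAlgebra 𝔐] [PartialOrder 𝔐] [StarOrderedRing 𝔐]
  [CStarAlgebra 𝔅] [PartialOrder 𝔅] [StarOrderedRing 𝔅]

theorem trace_mul_nonneg {τ : 𝔐 →ₚ[ℂ] ℂ} (htr : ∀ a b, τ (a * b) = τ (b * a)) {a b : 𝔐}
    (ha : 0 ≤ a) (hb : 0 ≤ b) : 0 ≤ τ (a * b) := by
  obtain ⟨s, rfl⟩ := (CStarAlgebra.nonneg_iff_eq_star_mul_self).1 ha
  rw [mul_assoc, htr]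
  exact map_nonneg τ (star_right_conjugate_nonneg hb s)

theorem trace_star_eq (τ : 𝔐 →ₚ[ℂ] ℂ) (a : 𝔐) : τ (star a) = star (τ a) := map_star τ a

/-- The part of the polar decomposition needed to compare dual norms: a subalgebra realizes
`Re τ(c* a)` up to `δ` by elements of norm at most `‖a‖`. -/
theorem exists_re_trace_le {τ : 𝔐 →ₚ[ℂ] ℂ} (htr : ∀ a b, τ (a * b) = τ (b * a)) (h1 : τ 1 = 1)
    (ι : 𝔅 →⋆ₐ[ℂ] 𝔐) (c : 𝔅) (a : 𝔐) {δ : ℝ} (hδ : 0 < δ) :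
    ∃ b : 𝔅, ‖b‖ ≤ ‖a‖ ∧ (τ (ι (star c) * a)).re ≤ (τ (ι (star c) * ι b)).re + δ := by
  rcases eq_or_ne a 0 with rfl | ha
  · exact ⟨0, by simp, by simpa using hδ.le⟩
  have hr : 0 < ‖a‖ := norm_pos_iff.2 ha
  set r := ‖a‖ with hrdef
  -- The regularization error below is at most `r η`, which equals `δ`.
  set η : ℝ := δ / r with hη
  have hη0 : 0 < η := by positivity
  set x := star c * c with hx
  have hx0 : 0 ≤ x := star_mul_self_nonneg c
  have hle : algebraMap ℝ 𝔅 (η ^ 2) ≤ x + algebraMap ℝ 𝔅 (η ^ 2) := le_add_of_nonneg_left hx0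
  have hηp : 0 ≤ algebraMap ℝ 𝔅 (η ^ 2) := by
    rw [← map_zero (algebraMap ℝ 𝔅)]; exact algebraMap_mono 𝔅 (by positivity)
  have hxη : 0 ≤ x + algebraMap ℝ 𝔅 (η ^ 2) := hηp.trans hle
  -- `s` is an invertible substitute for `|c|`, so `c s⁻¹` is a contraction approximating the
  -- partial isometry in the polar decomposition of `c`. The witness is `r c s⁻¹`.
  set s := CFC.sqrt (x + algebraMap ℝ 𝔅 (η ^ 2)) with hs
  have hs0 : 0 ≤ s := CFC.sqrt_nonneg _
  have hss : s * s = x + algebraMap ℝ 𝔅 (η ^ 2) := CFC.sqrt_mul_sqrt_self _ hxη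
  have hsu : IsUnit s := by
    refine (CFC.isUnit_sqrt_iff _ hxη).2 (CStarAlgebra.isUnit_of_le (algebraMap ℝ 𝔅 (η ^ 2)) hle ?_)
    rw [IsStrictlyPositive.iff_of_unital]
    exact ⟨hηp, (isUnit_iff_ne_zero.2 (by positivity)).map (algebraMap ℝ 𝔅)⟩
  set t := Ring.inverse s with ht
  have hst : s * t = 1 := Ring.mul_inverse_cancel _ hsu
  have hts : t * s = 1 := Ring.inverse_mul_cancel _ hsu
  have htsa : star t = t := by
    rw [ht, ← Ring.inverse_star, hs0.isSelfAdjoint.star_eq]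
  have ht0 : 0 ≤ t := by
    have := star_left_conjugate_nonneg hs0 t
    rwa [htsa, hts, one_mul] at this
  have hηt : η ^ 2 • (t * t) ≤ 1 := by
    have := star_left_conjugate_le_conjugate hle t
    rw [htsa, ← hss, ← mul_assoc, hts, one_mul, hst, Algebra.algebraMap_eq_smul_one,
      mul_smul_comm, mul_one, smul_mul_assoc] at this
    exact this
  have hηt' : η • t ≤ 1 := by
    have h := star_mul_self_nonneg (1 - η • t)
    have e : star (1 - η • t) * (1 - η • t) = 1 + η ^ 2 • (t * t) - (2 : ℝ) • (η • t) := by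
      rw [star_sub, star_one, star_smul, htsa, star_trivial]
      simp only [sub_mul, mul_sub, one_mul, mul_one, smul_mul_assoc, mul_smul_comm]
      module
    rw [e, sub_nonneg] at h
    have h' : (2 : ℝ) • (η • t) ≤ (2 : ℝ) • 1 :=
      h.trans ((add_le_add_right hηt 1).trans (le_of_eq (by rw [two_smul])))
    have := smul_le_smul_of_nonneg_left h' (show (0 : ℝ) ≤ 2⁻¹ by norm_num)
    rwa [inv_smul_smul₀ (by norm_num), inv_smul_smul₀ (by norm_num)] at this
  have htxt : t * x * t ≤ 1 := by
    have hxs : x ≤ s * s := by rw [hss]; exact le_add_of_nonneg_right hηp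
    have := star_left_conjugate_le_conjugate hxs t
    rwa [htsa, ← mul_assoc t s s, hts, one_mul, hst] at this
  have htx : t * x = s - η ^ 2 • t := by
    have : x = s * s - algebraMap ℝ 𝔅 (η ^ 2) := by rw [hss, add_sub_cancel_right]
    rw [this, mul_sub, ← mul_assoc, hts, one_mul, Algebra.algebraMap_eq_smul_one, mul_smul_comm,
      mul_one]
  have hmono : Monotone fun y : 𝔅 => τ (ι y) := fun y z hyz =>
    OrderHomClass.mono τ (OrderHomClass.mono ι hyz)
  have hreal (q : ℝ) (y : 𝔅) : τ (ι (q • y)) = q * τ (ι y) := by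
    rw [← Complex.coe_smul, map_smul, map_smul, smul_eq_mul]
  refine ⟨r • (c * t), ?_, ?_⟩
  · have h2 : ‖c * t‖ ≤ 1 := by
      have : ‖star (c * t) * (c * t)‖ ≤ 1 := by
        rw [star_mul, htsa, mul_assoc, ← mul_assoc (star c), ← hx, ← mul_assoc]
        refine (CStarAlgebra.norm_le_norm_of_nonneg_of_le ?_ htxt).trans ?_
        · have := star_left_conjugate_nonneg hx0 t
          rwa [htsa] at this
        · rcases subsingleton_or_nontrivial 𝔅 with h | h
          · simp [Subsingleton.elim (1 : 𝔅) 0]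
          · exact CStarRing.norm_one.le
      rw [CStarRing.norm_star_mul_self] at this
      nlinarith [norm_nonneg (c * t)]
    calc ‖r • (c * t)‖ = r * ‖c * t‖ := by rw [norm_smul, Real.norm_of_nonneg hr.le]
      _ ≤ r := by nlinarith
  · have hb : τ (ι (star c) * ι (r • (c * t))) = r * τ (ι (t * x)) := by
      rw [← map_mul, mul_smul_comm, hreal, ← mul_assoc, ← hx, map_mul, htr, ← map_mul]
    set w := ι (c * t * star c) with hw
    have hw0 : 0 ≤ w := map_nonneg ι (star_right_conjugate_nonneg ht0 c)
    have hτw : τ w = τ (ι (t * x)) := by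
      rw [hw, mul_assoc, map_mul, htr, ← map_mul, mul_assoc, ← hx]
    have hA : τ (star a * w * a) ≤ r ^ 2 * τ (ι (t * x)) := by
      have h2 : 0 ≤ algebraMap ℝ 𝔐 (r ^ 2) - a * star a :=
        sub_nonneg.2 CStarAlgebra.mul_star_le_algebraMap_norm_sq
      have h3 := trace_mul_nonneg htr hw0 h2
      rw [mul_sub, map_sub, sub_nonneg, Algebra.algebraMap_eq_smul_one, mul_smul_comm, mul_one,
        ← Complex.coe_smul, map_smul, smul_eq_mul, hτw] at h3
      rw [mul_assoc, htr, mul_assoc]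
      simpa using h3
    -- Cauchy–Schwarz in quadratic form: expanding gives `2 r Re τ(c* a) ≤ τ(a* w a) + r² τ(s)`.
    -- Here `τ(a* w a) ≤ r² τ(t x)`, and `τ(s)` exceeds `τ(t x)` by `η² τ(t) ≤ η`.
    have hB : 0 ≤ τ (star (ι (star c) * a - r • ι s) * ι t * (ι (star c) * a - r • ι s)) :=
      map_nonneg τ (star_left_conjugate_nonneg (map_nonneg ι ht0) _)
    have hC : star (ι (star c) * a - r • ι s) * ι t * (ι (star c) * a - r • ι s) =
        star a * w * a - r • (star (ι (star c) * a)) - r • (ι (star c) * a) + r ^ 2 • ι s := by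
      have e1 : ι t * ι s = 1 := by rw [← map_mul, hts, map_one]
      have e2 : ι s * ι t = 1 := by rw [← map_mul, hst, map_one]
      have e3 : star (ι s) = ι s := by rw [← map_star, hs0.isSelfAdjoint.star_eq]
      have e4 : star (ι (star c) * a) * ι t * (ι (star c) * a) = star a * w * a := by
        rw [hw, star_mul, ← map_star, star_star, map_mul, map_mul]
        simp only [mul_assoc]
      rw [star_sub, star_smul, e3, star_trivial r, sub_mul, sub_mul, mul_sub, mul_sub, e4,
        mul_smul_comm, mul_assoc _ (ι t) (ι s), e1, mul_one, smul_mul_assoc, smul_mul_assoc, e2,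
        one_mul, smul_mul_assoc, one_mul, smul_smul, ← sq]
      abel
    have hrealM (q : ℝ) (y : 𝔐) : τ (q • y) = q * τ y := by
      rw [← Complex.coe_smul, map_smul, smul_eq_mul]
    rw [hC, map_add, map_sub, map_sub, hrealM, hrealM, hrealM, trace_star_eq] at hB
    have hB' := (Complex.le_def.1 hB).1
    have hA' := (Complex.le_def.1 hA).1
    have hts' : (τ (ι s)).re = (τ (ι (t * x))).re + η ^ 2 * (τ (ι t)).re := by
      have : s = t * x + η ^ 2 • t := by rw [htx, sub_add_cancel]
      conv_lhs => rw [this]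
      rw [map_add, map_add, hreal, Complex.add_re, Complex.re_ofReal_mul]
    have hηt'' : η * (τ (ι t)).re ≤ 1 := by
      have := (Complex.le_def.1 (hmono hηt')).1
      simpa [hreal, h1] using this
    rw [hb]
    simp only [Complex.add_re, Complex.sub_re, Complex.re_ofReal_mul, ← Complex.ofReal_pow,
      Complex.zero_re, Complex.star_def, Complex.conj_re] at hB' hA' ⊢
    rw [hts'] at hB'
    have hηr : η * r = δ := by rw [hη]; field_simp
    have h5 : r * (2 * (τ (ι (star c) * a)).re) ≤
        r * (2 * (r * (τ (ι (t * x))).re) + r * η * (η * (τ (ι t)).re)) := by nlinarith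
    have h6 := le_of_mul_le_mul_left h5 hr
    have h7 : r * η * (η * (τ (ι t)).re) ≤ r * η * 1 := by gcongr
    nlinarith

end Polar
/-! ### Trace preserving conditional expectations -/

section CondExp

open Filter Topology

variable {H : Type*} [NormedAddCommGroup H] [InnerProductSpace ℂ H] [CompleteSpace H]

/-- The inclusion of a von Neumann subalgebra. -/
def inclusionHom {B M : VonNeumannAlgebra H} (hBM : B ≤ M) : B →⋆ₐ[ℂ] M where
  toFun := Set.inclusion hBM
  map_one' := rfl
  map_mul' _ _ := rfl
  map_zero' := rfl
  map_add' _ _ := rfl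
  commutes' _ := rfl
  map_star' _ := rfl

@[simp]
theorem coe_inclusionHom {B M : VonNeumannAlgebra H} (hBM : B ≤ M) (b : B) :
    ((inclusionHom hBM b : M) : H →L[ℂ] H) = b := rfl

theorem inclusionHom_mem_within {B M : VonNeumannAlgebra H} (hBM : B ≤ M) (b : B) :
    inclusionHom hBM b ∈ B.within M := b.2

variable {M : VonNeumannAlgebra H} {τ : M →ₚ[ℂ] ℂ}

/-- A normal trace is a vector functional on `ℓ²(ℕ, H)`. -/
theorem exists_vector (hτ : VonNeumannAlgebra.IsFaithfulNormalTraceState τ) :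
    ∃ Ξ : lp (fun _ : ℕ => H) 2, (∀ a b : M, ⟪orbit Ξ a, orbit Ξ b⟫_ℂ = τ (star a * b)) ∧
      ∀ a ∈ M, (∀ k, a (Ξ k) = 0) → a = 0 := by
  obtain ⟨ξ, hξ, hsum⟩ := hτ.normal
  refine ⟨⟨ξ, memℓp_gen (by simpa using hξ)⟩, fun a b => ?_, fun a ha h0 => ?_⟩
  · refine (lp.hasSum_inner _ _).unique ((hsum (star a * b)).congr_fun fun k => ?_)
    change _ = ⟪ξ k, (star (a : H →L[ℂ] H)) ((b : H →L[ℂ] H) (ξ k))⟫_ℂ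
    rw [ContinuousLinearMap.star_eq_adjoint, ContinuousLinearMap.adjoint_inner_right]
    rfl
  · have h1 := hτ.faithful ⟨a, ha⟩ ((hsum _).unique ((hasSum_zero (α := ℂ)).congr_fun fun k => ?_))
    · exact congrArg Subtype.val h1
    · change ⟪ξ k, (star a) (a (ξ k))⟫_ℂ = 0
      rw [show a (ξ k) = 0 from h0 k, map_zero, inner_zero_right]

theorem norm_orbit_le (Ξ : lp (fun _ : ℕ => H) 2) (a : H →L[ℂ] H) :
    ‖orbit Ξ a‖ ≤ ‖a‖ * ‖Ξ‖ :=
  (diagMap a).le_of_opNorm_le (LinearMap.mkContinuous_norm_le _ (norm_nonneg a) _) Ξ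

/-- The projection `x₀` of the orbit of `a` onto the closed orbit `V` of `B` has the right inner
products. What must be shown is that it comes from a bounded element of `B`. The orbit of the
`‖a‖`-ball of `B` is closed and convex, and a functional separating `x₀` from it would contradict
`exists_re_trace_le`. -/
theorem exists_condExp_apply (hτ : VonNeumannAlgebra.IsFaithfulNormalTraceState τ)
    {B : VonNeumannAlgebra H} (hBM : B ≤ M) (a : M) :
    ∃ y : B, ‖y‖ ≤ ‖a‖ ∧
      ∀ b, τ (inclusionHom hBM y * inclusionHom hBM b) = τ (a * inclusionHom hBM b) := by
  obtain ⟨Ξ, hΞ, hsep⟩ := exists_vector hτ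
  set 𝒞 := orbit Ξ '' {b | b ∈ B ∧ ‖b‖ ≤ ‖a‖} with h𝒞
  have hclosed : IsClosed 𝒞 := isClosed_orbit_ball hBM Ξ hsep ‖a‖
  have hconv : Convex ℝ 𝒞 := by
    refine Convex.is_linear_image (f := orbit Ξ) ?_ ⟨map_add _, fun c x => ?_⟩
    · rintro x ⟨hx, hx'⟩ y ⟨hy, hy'⟩ s t hs ht hst
      refine ⟨add_mem ?_ ?_, ?_⟩
      · rw [← Complex.coe_smul]; exact SMulMemClass.smul_mem _ hx
      · rw [← Complex.coe_smul]; exact SMulMemClass.smul_mem _ hy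
      · have := (convex_closedBall (0 : H →L[ℂ] H) ‖a‖) (by simpa using hx') (by simpa using hy')
          hs ht hst
        simpa using this
    · rw [← Complex.coe_smul, map_smul, Complex.coe_smul]; rfl
  set W := B.toStarSubalgebra.toSubalgebra.toSubmodule.map (orbit Ξ) with hW
  set V := W.topologicalClosure with hV
  have hVc : IsClosed (V : Set (lp (fun _ : ℕ => H) 2)) :=
    Submodule.isClosed_topologicalClosure _
  have : CompleteSpace V := hVc.completeSpace_coe
  have hWV (b : B) : orbit Ξ b ∈ V := Submodule.le_topologicalClosure _ ⟨b, b.2, rfl⟩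
  set x₀ := V.starProjection (orbit Ξ a) with hx₀
  have hproj (b : B) : ⟪orbit Ξ b, x₀⟫_ℂ = ⟪orbit Ξ b, orbit Ξ a⟫_ℂ := by
    rw [hx₀, ← Submodule.inner_starProjection_left_eq_right,
      Submodule.starProjection_eq_self_iff.2 (hWV b)]
  have hmem : x₀ ∈ 𝒞 := by
    by_contra hcon
    obtain ⟨f, u, hfu, hux⟩ := RCLike.geometric_hahn_banach_closed_point (𝕜 := ℂ) hconv hclosed hcon
    set θ := V.starProjection ((InnerProductSpace.toDual ℂ _).symm f) with hθ
    have hθf (x : lp (fun _ : ℕ => H) 2) (hx : x ∈ V) : f x = ⟪θ, x⟫_ℂ := by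
      rw [hθ, Submodule.inner_starProjection_left_eq_right,
        Submodule.starProjection_eq_self_iff.2 hx, InnerProductSpace.toDual_symm_apply]
    have hθV : θ ∈ V := V.starProjection_apply_mem _
    have hx₀V : x₀ ∈ V := V.starProjection_apply_mem _
    set g := RCLike.re (f x₀) - u with hg
    have hg0 : 0 < g := sub_pos.2 hux
    -- Replacing `θ` by the orbit of some `c ∈ B` costs at most `g / 2` in total. The polar estimate
    -- costs another `g / 4`, which together stay below the separation gap `g`.
    set N := ‖x₀‖ + ‖a‖ * ‖Ξ‖ + 1 with hN
    have hN0 : 0 < N := by positivity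
    obtain ⟨_, ⟨c, hc, rfl⟩, hcd⟩ := Metric.mem_closure_iff.1 hθV (g / (2 * N)) (by positivity)
    rw [dist_eq_norm] at hcd
    obtain ⟨b, hb, hle⟩ := exists_re_trace_le hτ.trace hτ.map_one (inclusionHom hBM) ⟨c, hc⟩ a
      (δ := g / 4) (by positivity)
    have h1 : (⟪θ, x₀⟫_ℂ).re ≤ (⟪orbit Ξ c, x₀⟫_ℂ).re + g / (2 * N) * ‖x₀‖ := by
      have h2 : (⟪θ - orbit Ξ c, x₀⟫_ℂ).re ≤ g / (2 * N) * ‖x₀‖ :=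
        (Complex.re_le_norm _).trans ((norm_inner_le_norm _ _).trans (by gcongr))
      rw [inner_sub_left, Complex.sub_re] at h2
      linarith
    have h2 : (⟪orbit Ξ c, orbit Ξ b⟫_ℂ).re ≤
        (⟪θ, orbit Ξ b⟫_ℂ).re + g / (2 * N) * (‖a‖ * ‖Ξ‖) := by
      have h2 : (⟪orbit Ξ c - θ, orbit Ξ b⟫_ℂ).re ≤ g / (2 * N) * (‖a‖ * ‖Ξ‖) := by
        refine (Complex.re_le_norm _).trans ((norm_inner_le_norm _ _).trans ?_)
        have h4 : ‖orbit Ξ (b : H →L[ℂ] H)‖ ≤ ‖a‖ * ‖Ξ‖ :=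
          (norm_orbit_le Ξ _).trans (mul_le_mul_of_nonneg_right hb (norm_nonneg _))
        rw [norm_sub_rev]
        gcongr
      rw [inner_sub_left, Complex.sub_re] at h2
      linarith
    have h3 : (⟪orbit Ξ c, x₀⟫_ℂ).re ≤ (⟪orbit Ξ c, orbit Ξ b⟫_ℂ).re + g / 4 := by
      have e1 := hproj ⟨c, hc⟩
      have e2 := hΞ (inclusionHom hBM ⟨c, hc⟩) a
      have e3 := hΞ (inclusionHom hBM ⟨c, hc⟩) (inclusionHom hBM b)
      simp only [coe_inclusionHom] at e1 e2 e3
      rw [e1, e2, e3, ← map_star]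
      exact hle
    have h4 : (⟪θ, orbit Ξ b⟫_ℂ).re < u := by
      rw [← hθf _ (hWV b)]
      exact hfu _ ⟨b, ⟨b.2, hb⟩, rfl⟩
    have h5 : (⟪θ, x₀⟫_ℂ).re = u + g := by
      rw [← hθf _ hx₀V, hg]; simp
    have h6 : g / (2 * N) * ‖x₀‖ + g / (2 * N) * (‖a‖ * ‖Ξ‖) ≤ g / 2 := by
      calc _ = g / (2 * N) * (‖x₀‖ + ‖a‖ * ‖Ξ‖) := by ring
        _ ≤ g / (2 * N) * N := by gcongr; linarith
        _ = g / 2 := by field_simp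
    linarith
  obtain ⟨y, ⟨hyB, hyn⟩, hy⟩ := hmem
  refine ⟨⟨y, hyB⟩, hyn, fun b => ?_⟩
  have e1 := hproj (star b)
  rw [← hy] at e1
  have e2 := hΞ (inclusionHom hBM (star b)) a
  have e3 := hΞ (inclusionHom hBM (star b)) (inclusionHom hBM ⟨y, hyB⟩)
  simp only [coe_inclusionHom] at e2 e3
  rw [e2, e3, map_star, star_star] at e1
  rw [hτ.trace, e1, hτ.trace]

theorem exists_condExp (hτ : VonNeumannAlgebra.IsFaithfulNormalTraceState τ)
    {B : VonNeumannAlgebra H} (hBM : B ≤ M) :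
    ∃ E : M →L[ℂ] B, ∀ a b,
      τ (inclusionHom hBM (E a) * inclusionHom hBM b) = τ (a * inclusionHom hBM b) := by
  choose e hn he using exists_condExp_apply hτ hBM
  have huniq (y z : B) (h : ∀ b, τ (inclusionHom hBM y * inclusionHom hBM b) =
      τ (inclusionHom hBM z * inclusionHom hBM b)) : y = z := by
    have h0 := hτ.faithful (inclusionHom hBM (y - z)) (by
      rw [hτ.trace, ← map_star, map_sub, sub_mul, map_sub, h, sub_self])
    exact sub_eq_zero.1 (Subtype.ext (congrArg (fun T : M => (T : H →L[ℂ] H)) h0))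
  refine ⟨LinearMap.mkContinuous ⟨⟨e, fun a b => huniq _ _ fun c => ?_⟩,
    fun r a => huniq _ _ fun c => ?_⟩ 1 fun a => by simpa using hn a, he⟩
  · rw [he, map_add, add_mul, add_mul, map_add, map_add, he, he]
  · rw [he, RingHom.id_apply, map_smul, smul_mul_assoc, smul_mul_assoc, map_smul, map_smul, he]

/-- A functional `τ(y ·)` that vanishes on a `⋆`-algebra vanishes on its double commutant. -/
theorem trace_mul_eq_zero_of_generated (hτ : VonNeumannAlgebra.IsFaithfulNormalTraceState τ)
    {A : Subalgebra ℂ M} (hA : ∀ a ∈ A, star a ∈ A) {y : M} (hy : ∀ m ∈ A, τ (y * m) = 0) {m : M}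
    (hm : (m : H →L[ℂ] H) ∈ VonNeumannAlgebra.generated ((fun a : M => (a : H →L[ℂ] H)) '' A)) :
    τ (y * m) = 0 := by
  obtain ⟨Ξ, hΞ, -⟩ := exists_vector hτ
  let A' : StarSubalgebra ℂ (H →L[ℂ] H) :=
    { (A.map (M.toStarSubalgebra.subtype : M →ₐ[ℂ] (H →L[ℂ] H))) with
      star_mem' := by
        rintro _ ⟨a, ha, rfl⟩
        exact ⟨star a, hA a ha, rfl⟩ }
  have hA's : star (A' : Set (H →L[ℂ] H)) = A' := by
    ext x; simp
  have hm' : (m : H →L[ℂ] H) ∈ Set.centralizer (Set.centralizer (A' : Set (H →L[ℂ] H))) := by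
    have h1 : (m : H →L[ℂ] H) ∈ StarSubalgebra.centralizer ℂ
      (StarSubalgebra.centralizer ℂ (A' : Set (H →L[ℂ] H)) : Set (H →L[ℂ] H)) := hm
    rw [← SetLike.mem_coe, StarSubalgebra.coe_centralizer_centralizer, hA's, Set.union_self] at h1
    exact h1
  have hcl := orbit_mem_closure A' Ξ hm'
  have hcont : Continuous fun x : lp (fun _ : ℕ => H) 2 => ⟪orbit Ξ (star y : M), x⟫_ℂ := by
    fun_prop
  have hz : IsClosed {x : lp (fun _ : ℕ => H) 2 | ⟪orbit Ξ (star y : M), x⟫_ℂ = 0} :=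
    isClosed_eq hcont continuous_const
  have hsub : (A'.toSubalgebra.toSubmodule.map (orbit Ξ) : Set (lp (fun _ : ℕ => H) 2)) ⊆
      {x | ⟪orbit Ξ (star y : M), x⟫_ℂ = 0} := by
    rintro _ ⟨_, ⟨d, hd, rfl⟩, rfl⟩
    have := hΞ (star y) d
    rw [star_star, hy d hd] at this
    exact this
  have h := closure_minimal hsub hz hcl
  have h2 := hΞ (star y) m
  rw [star_star] at h2
  rw [← h2]
  exact h

end CondExp
/-! ### Matrix amplification of the abstract setting -/

section MatrixSetting

theorem amplify_apply {K : Type*} [Zero K] (n : ℕ) (x : K) (i j : Fin n) :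
    amplify n x i j = if i = j then x else 0 := rfl

theorem amplify_mul_apply {K : Type*} [Ring K] {n : ℕ} (x : K) (T : CStarMatrix (Fin n) (Fin n) K)
    (i j : Fin n) : (amplify n x * T) i j = x * T i j := by
  simp [CStarMatrix.mul_apply, amplify_apply]

theorem mul_amplify_apply {K : Type*} [Ring K] {n : ℕ} (x : K) (T : CStarMatrix (Fin n) (Fin n) K)
    (i j : Fin n) : (T * amplify n x) i j = T i j * x := by
  simp [CStarMatrix.mul_apply, amplify_apply]

theorem amplify_mul {K : Type*} [Ring K] (n : ℕ) (x y : K) :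
    amplify n x * amplify n y = amplify n (x * y) := by
  ext i j
  rw [amplify_mul_apply, amplify_apply, amplify_apply]
  split_ifs <;> simp

theorem amplify_smul {K : Type*} [Ring K] [Algebra ℂ K] (n : ℕ) (c : ℂ) (x : K) :
    amplify n (c • x) = c • amplify n x := by
  ext i j
  rw [CStarMatrix.smul_apply, amplify_apply, amplify_apply]
  split_ifs <;> simp

theorem amplify_star {K : Type*} [Ring K] [StarRing K] (n : ℕ) (x : K) :
    star (amplify n x) = amplify n (star x) := by
  ext i j
  rw [CStarMatrix.star_apply, amplify_apply, amplify_apply]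
  by_cases h : i = j
  · simp [h]
  · simp [h, Ne.symm h]

theorem amplify_sub_smul_one {K : Type*} [Ring K] [Algebra ℂ K] (n : ℕ) (c : ℂ) (x : K) :
    amplify n x - c • (1 : CStarMatrix (Fin n) (Fin n) K) = amplify n (x - c • 1) := by
  ext i j
  rw [CStarMatrix.sub_apply, CStarMatrix.smul_apply, amplify_apply, amplify_apply,
    CStarMatrix.one_apply]
  split_ifs <;> simp

variable {𝔐 𝔅 : Type*} [CStarAlgebra 𝔐] [PartialOrder 𝔐] [StarOrderedRing 𝔐]
  [CStarAlgebra 𝔅] [PartialOrder 𝔅] [StarOrderedRing 𝔅]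

/-- Entrywise application of a `⋆`-homomorphism. -/
def matrixHom (n : ℕ) (ι : 𝔅 →⋆ₐ[ℂ] 𝔐) :
    CStarMatrix (Fin n) (Fin n) 𝔅 →⋆ₐ[ℂ] CStarMatrix (Fin n) (Fin n) 𝔐 where
  toFun T := T.map ι
  map_one' := by
    ext i j
    rw [CStarMatrix.map_apply, CStarMatrix.one_apply, CStarMatrix.one_apply]
    split_ifs <;> simp
  map_mul' S T := by ext i j; simp [CStarMatrix.mul_apply]
  map_zero' := by ext i j; simp
  map_add' S T := by ext i j; simp
  commutes' r := by
    ext i j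
    simp only [Algebra.algebraMap_eq_smul_one, CStarMatrix.map_apply, CStarMatrix.smul_apply,
      map_smul, CStarMatrix.one_apply]
    split_ifs <;> simp
  map_star' T := by ext i j; simp [CStarMatrix.star_apply, map_star]

@[simp]
theorem matrixHom_apply (n : ℕ) (ι : 𝔅 →⋆ₐ[ℂ] 𝔐) (T : CStarMatrix (Fin n) (Fin n) 𝔅)
    (i j : Fin n) : matrixHom n ι T i j = ι (T i j) := rfl

theorem continuous_entry {n : ℕ} (i j : Fin n) :
    Continuous fun T : CStarMatrix (Fin n) (Fin n) 𝔐 => T i j :=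
  (continuous_apply j).comp (continuous_apply (A := fun _ => Fin n → 𝔐) i)

/-- Entrywise application of a continuous linear map. -/
noncomputable def matrixCLM (n : ℕ) (E : 𝔐 →L[ℂ] 𝔅) :
    CStarMatrix (Fin n) (Fin n) 𝔐 →L[ℂ] CStarMatrix (Fin n) (Fin n) 𝔅 where
  toLinearMap := CStarMatrix.mapₗ E.toLinearMap
  cont := continuous_pi fun i => continuous_pi fun j => E.continuous.comp (continuous_entry i j)

@[simp]
theorem matrixCLM_apply (n : ℕ) (E : 𝔐 →L[ℂ] 𝔅) (T : CStarMatrix (Fin n) (Fin n) 𝔐)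
    (i j : Fin n) : matrixCLM n E T i j = E (T i j) := rfl

/-- `τ ⊗ tr_n` as a continuous functional. -/
noncomputable def matrixTrace (n : ℕ) (τ : 𝔐 →L[ℂ] ℂ) :
    CStarMatrix (Fin n) (Fin n) 𝔐 →L[ℂ] ℂ where
  toLinearMap := matrixFunctional τ.toLinearMap n
  cont := continuous_const.mul (continuous_finsetSum _ fun i _ =>
    τ.continuous.comp (continuous_entry i i))

theorem matrixTrace_apply (n : ℕ) (τ : 𝔐 →L[ℂ] ℂ) (T : CStarMatrix (Fin n) (Fin n) 𝔐) :
    matrixTrace n τ T = (n : ℂ)⁻¹ * ∑ i, τ (T i i) := rfl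

theorem matrixTrace_mul (n : ℕ) (τ : 𝔐 →L[ℂ] ℂ) (S T : CStarMatrix (Fin n) (Fin n) 𝔐) :
    matrixTrace n τ (S * T) = (n : ℂ)⁻¹ * ∑ i, ∑ k, τ (S i k * T k i) := by
  simp [matrixTrace_apply, CStarMatrix.mul_apply]

/-- Matrices with entries in a subalgebra. -/
def matrixSubalgebra (n : ℕ) (C : Subalgebra ℂ 𝔐) :
    Subalgebra ℂ (CStarMatrix (Fin n) (Fin n) 𝔐) where
  carrier := {T | ∀ i j, T i j ∈ C}
  mul_mem' hS hT i j := by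
    rw [CStarMatrix.mul_apply]
    exact C.sum_mem fun k _ => C.mul_mem (hS i k) (hT k j)
  add_mem' hS hT i j := C.add_mem (hS i j) (hT i j)
  algebraMap_mem' r i j := by
    rw [Algebra.algebraMap_eq_smul_one, CStarMatrix.smul_apply, CStarMatrix.one_apply]
    split_ifs
    · exact C.smul_mem C.one_mem r
    · rw [smul_zero]; exact C.zero_mem

/-- Matrices with entries in a subspace. -/
def matrixSubmodule (n : ℕ) (𝒬 : Submodule ℂ 𝔐) :
    Submodule ℂ (CStarMatrix (Fin n) (Fin n) 𝔐) where
  carrier := {T | ∀ i j, T i j ∈ 𝒬}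
  add_mem' hS hT i j := 𝒬.add_mem (hS i j) (hT i j)
  zero_mem' _ _ := 𝒬.zero_mem
  smul_mem' c _ hT i j := 𝒬.smul_mem c (hT i j)

theorem isClosed_forall_entry_mem {n : ℕ} {s : Set 𝔐} (hs : IsClosed s) :
    IsClosed {T : CStarMatrix (Fin n) (Fin n) 𝔐 | ∀ i j, T i j ∈ s} := by
  simp only [Set.ofPred_forall]
  exact isClosed_iInter fun i => isClosed_iInter fun j => hs.preimage (continuous_entry i j)

/-- Each axiom reduces to its entrywise version: `P ⊗ I_n` is diagonal, and `E` acts on entries, so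
a centered matrix has centered entries. -/
theorem IsCompressionSetting.matrix {ι : 𝔅 →⋆ₐ[ℂ] 𝔐} {τ : 𝔐 →L[ℂ] ℂ} {E : 𝔐 →L[ℂ] 𝔅} {P : 𝔐}
    {α : ℝ} {C : Subalgebra ℂ 𝔐} {𝒬 : Submodule ℂ 𝔐} (hS : IsCompressionSetting ι τ E P α C 𝒬)
    (n : ℕ) :
    IsCompressionSetting (matrixHom n ι) (matrixTrace n τ) (matrixCLM n E) (amplify n P) α
      (matrixSubalgebra n C) (matrixSubmodule n 𝒬) where
  trace a b := by
    rw [matrixTrace_mul, matrixTrace_mul, Finset.sum_comm]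
    simp only [hS.trace]
  trace_star a := by
    simp [matrixTrace_apply, CStarMatrix.star_apply, hS.trace_star]
  nonneg a := by
    rw [matrixTrace_mul]
    refine mul_nonneg ?_ (Finset.sum_nonneg fun i _ => Finset.sum_nonneg fun k _ => ?_)
    · rw [← Complex.ofReal_natCast, ← Complex.ofReal_inv, Complex.zero_le_real]
      positivity
    · rw [CStarMatrix.star_apply]
      exact hS.nonneg _
  faithful b hb := by
    ext i j
    -- The index `i` rules out `n = 0`, where the normalized trace is zero.
    have hn : (n : ℂ)⁻¹ ≠ 0 := inv_ne_zero (Nat.cast_ne_zero.2 (Fin.pos i).ne')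
    rw [map_mul, matrixTrace_mul, mul_eq_zero, or_iff_right hn] at hb
    have hnn (k l : Fin n) : 0 ≤ τ (matrixHom n ι (star b) k l * matrixHom n ι b l k) := by
      rw [matrixHom_apply, matrixHom_apply, CStarMatrix.star_apply, map_star]
      exact hS.nonneg _
    have h1 := (Finset.sum_eq_zero_iff_of_nonneg fun k _ =>
      Finset.sum_nonneg fun l _ => hnn k l).1 hb j (Finset.mem_univ _)
    have h2 := (Finset.sum_eq_zero_iff_of_nonneg fun l _ => hnn j l).1 h1 i (Finset.mem_univ _)
    rw [matrixHom_apply, matrixHom_apply, CStarMatrix.star_apply, ← map_mul] at h2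
    exact hS.faithful _ h2
  condExp a b := by
    rw [matrixTrace_mul, matrixTrace_mul]
    simp only [matrixHom_apply, matrixCLM_apply, hS.condExp]
  isStarProjection := ⟨by
    rw [IsIdempotentElem, amplify_mul, hS.isStarProjection.isIdempotentElem.eq], by
    rw [isSelfAdjoint_iff, amplify_star, hS.isStarProjection.isSelfAdjoint.star_eq]⟩
  comm b := by
    ext i j
    rw [amplify_mul_apply, mul_amplify_apply, matrixHom_apply, hS.comm]
  indep b := by
    rw [matrixTrace_apply, matrixTrace_apply]
    simp only [amplify_mul_apply, matrixHom_apply, hS.indep, ← Finset.mul_sum]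
    ring
  pos := hS.pos
  le_one := hS.le_one
  isClosed_subalgebra := isClosed_forall_entry_mem hS.isClosed_subalgebra
  range_le b i j := hS.range_le _
  isClosed_submodule := isClosed_forall_entry_mem hS.isClosed_submodule
  sub_mem i j := by
    rw [amplify_sub_smul_one, amplify_apply]
    split_ifs
    · exact hS.sub_mem
    · exact 𝒬.zero_mem
  mul_mem w hw v hv hEv i j := by
    rw [amplify_sub_smul_one, CStarMatrix.mul_apply]
    refine 𝒬.sum_mem fun k _ => ?_
    rw [amplify_mul_apply]
    refine hS.mul_mem _ (hw k j) _ (hv i k) ?_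
    rw [← matrixCLM_apply, hEv, CStarMatrix.zero_apply]
  vanish w hw m hm := by
    rw [matrixTrace_mul, Finset.sum_eq_zero, mul_zero]
    exact fun i _ => Finset.sum_eq_zero fun k _ => hS.vanish _ (hw i k) _ (hm k i)

end MatrixSetting

/-! ### Alternating words -/

section Words

variable {K : Type*} [Ring K] [Algebra ℂ K]

theorem IsFreeOver.list {κ : Type*} {φ : K →ₗ[ℂ] ℂ} {A : Subalgebra ℂ K} {S : κ → Subalgebra ℂ K}
    (h : IsFreeOver φ A S) (L : List (κ × K)) (hne : L ≠ []) (hmem : ∀ a ∈ L, a.2 ∈ S a.1)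
    (hch : L.IsChain fun a b => a.1 ≠ b.1) (hc : ∀ a ∈ L, IsCondExp φ A a.2 0) :
    IsCondExp φ A (L.map Prod.snd).prod 0 := by
  obtain ⟨k, hk⟩ := Nat.exists_eq_succ_of_ne_zero (List.length_pos_iff.2 hne).ne'
  have h1 := h k (fun j => (L.get (j.cast hk.symm)).1) (fun j => (L.get (j.cast hk.symm)).2)
    (fun j => hmem _ (List.get_mem _ _))
    (fun j => List.isChain_iff_getElem.1 hch j (by rw [hk]; exact Nat.succ_lt_succ j.2))
    (fun j => hc _ (List.get_mem _ _))
  have h2 : List.ofFn (fun j : Fin (k + 1) => (L.get (j.cast hk.symm)).2) = L.map Prod.snd := by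
    refine List.ext_getElem (by simp [hk]) fun i h1 h2 => ?_
    simp only [List.getElem_ofFn, List.getElem_map]
    rfl
  rwa [h2] at h1

/-- The alternating products `q v₁ q v₂ ⋯ q` with `vᵢ` centered elements of `A⟨x⟩`. -/
inductive IsAltWord (φ : K →ₗ[ℂ] ℂ) (A : Subalgebra ℂ K) (x q : K) : K → Prop
  | base : IsAltWord φ A x q q
  | step {v w : K} : v ∈ polys A x → IsCondExp φ A v 0 → IsAltWord φ A x q w →
      IsAltWord φ A x q (q * v * w)

/-- The first letter is kept explicit with tag `1`, the `y` side, so that a centered element of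
`A⟨x⟩` can be prepended without breaking alternation. -/
theorem IsAltWord.exists_list {φ : K →ₗ[ℂ] ℂ} {A : Subalgebra ℂ K} {x y q w : K}
    (hq : q ∈ polys A y) (hq0 : IsCondExp φ A q 0) (hw : IsAltWord φ A x q w) :
    ∃ (a : K) (L : List (Fin 2 × K)),
      (∀ b ∈ (1, a) :: L, b.2 ∈ (![polys A x, polys A y] : Fin 2 → Subalgebra ℂ K) b.1) ∧
      (((1, a) :: L).IsChain fun b c => b.1 ≠ c.1) ∧
      (∀ b ∈ (1, a) :: L, IsCondExp φ A b.2 0) ∧ (((1, a) :: L).map Prod.snd).prod = w := by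
  induction hw with
  | base => exact ⟨q, [], by simpa using hq, by simp, by simpa using hq0, by simp⟩
  | @step v w hv hv0 _ ih =>
    obtain ⟨a, L, h1, h2, h3, h4⟩ := ih
    refine ⟨q, (0, v) :: (1, a) :: L, ?_, ?_, ?_, ?_⟩
    · rw [List.forall_mem_cons, List.forall_mem_cons]
      exact ⟨hq, hv, h1⟩
    · rw [List.isChain_cons_cons, List.isChain_cons_cons]
      exact ⟨by simp, by simp, h2⟩
    · rw [List.forall_mem_cons, List.forall_mem_cons]
      exact ⟨hq0, hv0, h3⟩
    · rw [List.map_cons, List.map_cons, List.prod_cons, List.prod_cons, h4, mul_assoc]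

theorem AreFreeOver.isCondExp_word {φ : K →ₗ[ℂ] ℂ} {A : Subalgebra ℂ K} {x y q w : K}
    (h : AreFreeOver φ A x y) (hq : q ∈ polys A y) (hq0 : IsCondExp φ A q 0)
    (hw : IsAltWord φ A x q w) : IsCondExp φ A w 0 := by
  obtain ⟨a, L, h1, h2, h3, rfl⟩ := hw.exists_list hq hq0
  exact IsFreeOver.list h _ (by simp) h1 h2 h3

theorem AreFreeOver.isCondExp_mul_word {φ : K →ₗ[ℂ] ℂ} {A : Subalgebra ℂ K} {x y q w m : K}
    (h : AreFreeOver φ A x y) (hq : q ∈ polys A y) (hq0 : IsCondExp φ A q 0)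
    (hw : IsAltWord φ A x q w) (hm : m ∈ polys A x) (hm0 : IsCondExp φ A m 0) :
    IsCondExp φ A (m * w) 0 := by
  obtain ⟨a, L, h1, h2, h3, rfl⟩ := hw.exists_list hq hq0
  rw [← List.prod_cons]
  refine IsFreeOver.list h ((0, m) :: (1, a) :: L) (by simp) ?_ ?_ ?_
  · rw [List.forall_mem_cons]; exact ⟨hm, h1⟩
  · rw [List.isChain_cons_cons]; exact ⟨by simp, h2⟩
  · rw [List.forall_mem_cons]; exact ⟨hm0, h3⟩

theorem star_mem_polys [StarRing K] [StarModule ℂ K] {A : Subalgebra ℂ K}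
    (hA : ∀ a ∈ A, star a ∈ A) {X : K} (hX : IsSelfAdjoint X) {m : K} (hm : m ∈ polys A X) :
    star m ∈ polys A X := by
  induction hm using Algebra.adjoin_induction with
  | mem x hx =>
    rcases hx with hx | rfl
    · exact Algebra.subset_adjoin (Or.inl (hA x hx))
    · rw [hX.star_eq]; exact mem_polys_self A _
  | algebraMap r => rw [← algebraMap_star_comm]; exact Subalgebra.algebraMap_mem _ _
  | add x y _ _ hx hy => rw [star_add]; exact Subalgebra.add_mem _ hx hy
  | mul x y _ _ hx hy => rw [star_mul]; exact Subalgebra.mul_mem _ hy hx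

end Words
/-! ### The setting of a von Neumann algebra -/

section Concrete

variable {H : Type*} [NormedAddCommGroup H] [InnerProductSpace ℂ H] [CompleteSpace H]
  {M : VonNeumannAlgebra H} {τ : M →ₚ[ℂ] ℂ}

/-- The closed span of the alternating words in `p - τ(p)` and centered elements of `B⟨X⟩`. -/
noncomputable def altSpan (τ : M →ₚ[ℂ] ℂ) (A : Subalgebra ℂ M) (X q : M) : Submodule ℂ M :=
  (Submodule.span ℂ {w | IsAltWord τ.toLinearMap A X q w}).topologicalClosure

theorem mul_mem_altSpan {A : Subalgebra ℂ M} {X q v w : M} (hv : v ∈ polys A X)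
    (hv0 : IsCondExp τ.toLinearMap A v 0) (hw : w ∈ altSpan τ A X q) :
    q * v * w ∈ altSpan τ A X q := by
  refine map_mem_closure (continuous_const.mul continuous_id) hw fun x hx => ?_
  induction hx using Submodule.span_induction with
  | mem x hx => exact Submodule.subset_span (IsAltWord.step hv hv0 hx)
  | zero => simp
  | add x y _ _ hx hy =>
    simp only [mul_add] at hx hy ⊢
    exact Submodule.add_mem _ hx hy
  | smul c x _ hx =>
    simp only [mul_smul_comm] at hx ⊢
    exact Submodule.smul_mem _ c hx

theorem trace_proj_eq (hτ : VonNeumannAlgebra.IsFaithfulNormalTraceState τ) {p : M}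
    (hp : IsStarProjection p) (hp0 : p ≠ 0) :
    τ p = ((τ p).re : ℂ) ∧ 0 < (τ p).re ∧ (τ p).re ≤ 1 := by
  have hnn : 0 ≤ τ p := map_nonneg τ hp.nonneg
  have h1 : 0 ≤ τ (1 - p) := map_nonneg τ hp.one_sub.nonneg
  rw [map_sub, hτ.map_one, sub_nonneg] at h1
  have hre := Complex.le_def.1 hnn
  have heq : τ p = ((τ p).re : ℂ) := Complex.ext (by simp) (by simpa using hre.2.symm)
  refine ⟨heq, lt_of_le_of_ne hre.1 fun h0 => hp0 (hτ.faithful p ?_), by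
    simpa using (Complex.le_def.1 h1).1⟩
  rw [hp.isSelfAdjoint.star_eq, hp.isIdempotentElem.eq, heq, ← h0]
  simp

/-- Independence centers `p - τ(p)` over `B`. For the orthogonality, split `m ∈ B⟨X⟩` as `(m - E m)
+ E m`: the first part times an alternating word is again an alternating product, and the word
itself is centered, which handles the second. Closures follow by continuity. -/
theorem isCompressionSetting (hτ : VonNeumannAlgebra.IsFaithfulNormalTraceState τ)
    {B : VonNeumannAlgebra H} (hBM : B ≤ M) {X p : M} (hp : IsStarProjection p) (hp0 : p ≠ 0)
    (hfree : AreFreeOver τ.toLinearMap (B.within M) X p)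
    (hind : IsIndependentFrom τ.toLinearMap (B.within M) p) {E : M →L[ℂ] B}
    (hE : ∀ a b, τ (inclusionHom hBM (E a) * inclusionHom hBM b) = τ (a * inclusionHom hBM b)) :
    IsCompressionSetting (inclusionHom hBM) (⟨τ.toLinearMap, map_continuous τ⟩ : M →L[ℂ] ℂ) E p
      (τ p).re (polys (B.within M) X).topologicalClosure
      (altSpan τ (B.within M) X (p - ((τ p).re : ℂ) • 1)) := by
  obtain ⟨hα, hα0, hα1⟩ := trace_proj_eq hτ hp hp0
  set q := p - ((τ p).re : ℂ) • (1 : M) with hq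
  set A := B.within M with hA
  have hpadj : p ∈ Algebra.adjoin ℂ {p} := Algebra.subset_adjoin rfl
  have hcomm (b : B) : p * inclusionHom hBM b = inclusionHom hBM b * p :=
    (hind p hpadj _ (inclusionHom_mem_within hBM b)).1.eq
  have hindep (b : B) : τ (p * inclusionHom hBM b) = (τ p).re * τ (inclusionHom hBM b) := by
    rw [hcomm]
    have := (hind p hpadj _ (inclusionHom_mem_within hBM b)).2
    change τ _ = τ _ * τ p at this
    rw [this, mul_comm, ← hα]
  have hcond {a : M} : IsCondExp τ.toLinearMap A a 0 ↔
      ∀ b : B, τ (a * inclusionHom hBM b) = 0 := by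
    constructor
    · intro h b
      have := h.2 _ (inclusionHom_mem_within hBM b)
      rw [zero_mul, map_zero] at this
      exact this.symm
    · intro h
      refine ⟨A.zero_mem, fun b hb => ?_⟩
      rw [zero_mul, map_zero]
      exact (h ⟨b, hb⟩).symm
  have hq0 : IsCondExp τ.toLinearMap A q 0 := hcond.2 fun b => by
    rw [hq, sub_mul, map_sub, hindep, smul_mul_assoc, one_mul, map_smul, smul_eq_mul, sub_self]
  have hqp : q ∈ polys A p :=
    Subalgebra.sub_mem _ (mem_polys_self A p) (Subalgebra.smul_mem _ (Subalgebra.one_mem _) _)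
  have hBpolys (b : B) : inclusionHom hBM b ∈ polys A X :=
    Algebra.subset_adjoin (Or.inl (inclusionHom_mem_within hBM b))
  have hcent (m : M) : IsCondExp τ.toLinearMap A (m - inclusionHom hBM (E m)) 0 :=
    hcond.2 fun b => by rw [sub_mul, map_sub, hE, sub_self]
  have hτc : Continuous τ := map_continuous τ
  have hιE : Continuous fun m : M => inclusionHom hBM (E m) :=
    (map_continuous (inclusionHom hBM)).comp E.continuous
  have hvan_word {w : M} (hw : IsAltWord τ.toLinearMap A X q w) {m : M} (hm : m ∈ polys A X) :
      τ (w * m) = 0 := by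
    have h1 := hcond.1 (hfree.isCondExp_mul_word hqp hq0 hw
      (Subalgebra.sub_mem _ hm (hBpolys (E m))) (hcent m)) 1
    rw [map_one, mul_one, sub_mul, map_sub, hτ.trace _ w, hτ.trace _ w,
      hcond.1 (hfree.isCondExp_word hqp hq0 hw) (E m), sub_zero] at h1
    exact h1
  have hvan_polys {w : M} (hw : w ∈ altSpan τ A X q) {m : M} (hm : m ∈ polys A X) :
      τ (w * m) = 0 := by
    have hcl : IsClosed {w : M | τ (w * m) = 0} :=
      isClosed_eq (hτc.comp (continuous_id.mul continuous_const)) continuous_const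
    refine closure_minimal (fun x hx => ?_) hcl hw
    change τ (x * m) = 0
    induction hx using Submodule.span_induction with
    | mem x hx => exact hvan_word hx hm
    | zero => simp
    | add x y _ _ hx hy => rw [add_mul, map_add, hx, hy, add_zero]
    | smul c x _ hx => rw [smul_mul_assoc, map_smul, hx, smul_zero]
  exact
    { trace := hτ.trace
      trace_star := fun a => trace_star_eq τ a
      nonneg := fun a => map_nonneg τ (star_mul_self_nonneg a)
      faithful := fun b hb => by
        have h0 := hτ.faithful (inclusionHom hBM b) (by
          rw [← map_star, ← map_mul]; exact hb)
        exact Subtype.ext (congrArg (fun T : M => (T : H →L[ℂ] H)) h0)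
      condExp := hE
      isStarProjection := hp
      comm := hcomm
      indep := hindep
      pos := hα0
      le_one := hα1
      isClosed_subalgebra := Subalgebra.isClosed_topologicalClosure _
      range_le := fun b => Subalgebra.le_topologicalClosure _ (hBpolys b)
      isClosed_submodule := Submodule.isClosed_topologicalClosure _
      sub_mem := Submodule.le_topologicalClosure _ (Submodule.subset_span IsAltWord.base)
      mul_mem := fun w hw v hv hEv => by
        -- Elements of `B⟨X⟩` approximating a centered `v` need not be centered; subtracting their
        -- expectation corrects this and is continuous.
        have hcl : IsClosed {v : M | q * (v - inclusionHom hBM (E v)) * w ∈ altSpan τ A X q} :=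
          IsClosed.preimage (by fun_prop) (Submodule.isClosed_topologicalClosure _)
        have h : q * (v - inclusionHom hBM (E v)) * w ∈ altSpan τ A X q :=
          closure_minimal (fun x hx => mul_mem_altSpan
            (Subalgebra.sub_mem _ hx (hBpolys (E x))) (hcent x) hw) hcl hv
        rwa [hEv, map_zero, sub_zero] at h
      vanish := fun w hw m hm => by
        have hcl : IsClosed {m : M | τ (w * m) = 0} :=
          isClosed_eq (hτc.comp (continuous_const.mul continuous_id)) continuous_const
        exact closure_minimal (fun x hx => hvan_polys hw hx) hcl hm }

/-! ### Inverses of matrices over a von Neumann algebra -/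

/-- For `c` in the commutant of `W`, the matrix `c ⊗ I_n` commutes with `T`, hence with its inverse;
the bicommutant theorem then places the entries in `W`. -/
theorem matricesOver_inverse_mem {W : VonNeumannAlgebra H} {n : ℕ}
    {T S : CStarMatrix (Fin n) (Fin n) M} (hT : T ∈ matricesOver n (W.within M : Set M))
    (hTS : T * S = 1) (hST : S * T = 1) : S ∈ matricesOver n (W.within M : Set M) := by
  intro i j
  change (S i j : H →L[ℂ] H) ∈ W
  rw [← W.commutant_commutant, VonNeumannAlgebra.mem_commutant_iff]
  intro c hc
  let f : Matrix (Fin n) (Fin n) M →+* Matrix (Fin n) (Fin n) (H →L[ℂ] H) :=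
    (M.toStarSubalgebra.subtype : M →+* (H →L[ℂ] H)).mapMatrix
  have h1 : f (CStarMatrix.ofMatrix.symm T) * f (CStarMatrix.ofMatrix.symm S) = 1 := by
    rw [← map_mul, ← map_one f]; exact congrArg f hTS
  have h2 : f (CStarMatrix.ofMatrix.symm S) * f (CStarMatrix.ofMatrix.symm T) = 1 := by
    rw [← map_mul, ← map_one f]; exact congrArg f hST
  have h3 : Matrix.diagonal (fun _ => c) * f (CStarMatrix.ofMatrix.symm T) =
      f (CStarMatrix.ofMatrix.symm T) * Matrix.diagonal (fun _ => c) := by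
    ext1 k l
    rw [Matrix.diagonal_mul, Matrix.mul_diagonal]
    exact (VonNeumannAlgebra.mem_commutant_iff.1 hc _ (hT k l)).symm
  have h4 : Matrix.diagonal (fun _ => c) * f (CStarMatrix.ofMatrix.symm S) =
      f (CStarMatrix.ofMatrix.symm S) * Matrix.diagonal (fun _ => c) := by
    calc _ = f (CStarMatrix.ofMatrix.symm S) * (f (CStarMatrix.ofMatrix.symm T) *
          Matrix.diagonal (fun _ => c)) * f (CStarMatrix.ofMatrix.symm S) := by
          rw [← mul_assoc, h2, one_mul]
      _ = _ := by rw [← h3, mul_assoc, mul_assoc, h1, mul_one]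
  have h5 := congrFun (congrFun h4 i) j
  rw [Matrix.diagonal_mul, Matrix.mul_diagonal] at h5
  exact h5

theorem polys_le_wstarPolys (B : VonNeumannAlgebra H) {X m : M}
    (hm : m ∈ polys (B.within M) X) : m ∈ (wstarPolys B X).within M := by
  change (m : H →L[ℂ] H) ∈ StarSubalgebra.centralizer ℂ
      (StarSubalgebra.centralizer ℂ ((fun a : M => (a : H →L[ℂ] H)) '' polys (B.within M) X) :
        Set (H →L[ℂ] H))
  rw [← SetLike.mem_coe, StarSubalgebra.coe_centralizer_centralizer]
  exact Set.subset_centralizer_centralizer (Or.inl ⟨m, hm, rfl⟩)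

/-- A matrix orthogonal to `𝔐_n(B⟨X⟩)` is orthogonal to `𝔐_n(W*(B⟨X⟩))`. -/
theorem matrixFunctional_mul_eq_zero (hτ : VonNeumannAlgebra.IsFaithfulNormalTraceState τ)
    (B : VonNeumannAlgebra H) {X : M} (hX : IsSelfAdjoint X) {n : ℕ}
    {y : CStarMatrix (Fin n) (Fin n) M}
    (hy : ∀ m ∈ matricesOver n (polys (B.within M) X : Set M),
      matrixFunctional τ.toLinearMap n (y * m) = 0)
    {m : CStarMatrix (Fin n) (Fin n) M}
    (hm : m ∈ matricesOver n ((wstarPolys B X).within M : Set M)) :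
    matrixFunctional τ.toLinearMap n (y * m) = 0 := by
  have hent (i j : Fin n) (d : M) (hd : d ∈ polys (B.within M) X) : τ (y i j * d) = 0 := by
    have hn : (n : ℂ)⁻¹ ≠ 0 := inv_ne_zero (Nat.cast_ne_zero.2 (Fin.pos i).ne')
    -- The matrix with the single entry `d` at `(j, i)` isolates `τ(y i j * d)`.
    have h1 := hy (CStarMatrix.ofMatrix (Matrix.single j i d)) fun k l => by
      rw [CStarMatrix.ofMatrix_apply, Matrix.single_apply]
      split_ifs
      · exact hd
      · exact Subalgebra.zero_mem _
    change (n : ℂ)⁻¹ * ∑ k, τ ((y * CStarMatrix.ofMatrix (Matrix.single j i d)) k k) = 0 at h1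
    rw [mul_eq_zero, or_iff_right hn, Finset.sum_eq_single i, CStarMatrix.mul_apply,
      Finset.sum_eq_single j] at h1
    · simpa using h1
    · intro k _ hk
      simp [hk.symm]
    · simp
    · intro k _ hk
      rw [CStarMatrix.mul_apply, Finset.sum_eq_zero, map_zero]
      intro l _
      simp [hk.symm]
    · simp
  have hstar (a : M) (ha : a ∈ polys (B.within M) X) : star a ∈ polys (B.within M) X :=
    star_mem_polys (A := B.within M)
      (fun b hb => show star (b : H →L[ℂ] H) ∈ B from star_mem hb) hX ha
  change (n : ℂ)⁻¹ * ∑ k, τ ((y * m) k k) = 0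
  rw [Finset.sum_eq_zero, mul_zero]
  intro k _
  rw [CStarMatrix.mul_apply, map_sum]
  exact Finset.sum_eq_zero fun l _ =>
    trace_mul_eq_zero_of_generated hτ hstar (fun d hd => hent k l d hd) (hm l k)

end Concrete
end FreeCompression

/-! ### Analytic subordination for free compressions

The subordination function is `F β = α β - (1 - α) h(β)⁻¹`, with `h(β) = α⁻¹ E_B(R)`. The identity
`E(α⁻¹ R) = (X - F β)⁻¹` follows from freeness for small multiples of `X` and extends to `X` by
analytic continuation, so the conjugate variable `hJ` is not needed. -/

theorem mainTheorem3 {H : Type*} [NormedAddCommGroup H] [InnerProductSpace ℂ H] [CompleteSpace H]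
    (M : VonNeumannAlgebra H) (τ : M →ₚ[ℂ] ℂ)
    (hτ : VonNeumannAlgebra.IsFaithfulNormalTraceState τ)
    (B : VonNeumannAlgebra H) (hBM : B ≤ M)
    (X p : M) (hX : IsSelfAdjoint X) (hp : IsStarProjection p) (hp0 : p ≠ 0)
    (hfree : AreFreeOver τ.toLinearMap (B.within M) X p)
    (hind : IsIndependentFrom τ.toLinearMap (B.within M) p)
    (hJ : ∃ J : τ.GNS, IsL2ConjugateVariable τ B X J)
    (n : ℕ) :
    ∃ F : CStarMatrix (Fin n) (Fin n) B → CStarMatrix (Fin n) (Fin n) B,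
      AnalyticOnNhd ℂ F (upperHalfPlane (CStarMatrix (Fin n) (Fin n) B)) ∧
      Set.MapsTo F (upperHalfPlane (CStarMatrix (Fin n) (Fin n) B))
        (upperHalfPlane (CStarMatrix (Fin n) (Fin n) B)) ∧
      ∀ β ∈ upperHalfPlane (CStarMatrix (Fin n) (Fin n) B),
        ∃ R S : CStarMatrix (Fin n) (Fin n) M,
          -- `R` is the inverse of `X_p ⊗ I_n - β (p ⊗ I_n)` in `𝔐_n(pMp)`
          IsCornerInverse (amplify n p)
            (amplify n ((τ p)⁻¹ • (p * X * p)) - β.map (Set.inclusion hBM) * amplify n p) R ∧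
          -- `S` is the inverse of `X ⊗ I_n - F(β)` in `𝔐_n(M)`
          (amplify n X - (F β).map (Set.inclusion hBM)) * S = 1 ∧
          S * (amplify n X - (F β).map (Set.inclusion hBM)) = 1 ∧
          -- `S = E(α⁻¹ R)`, with `E` the conditional expectation onto `𝔐_n(W*(B⟨X⟩))`
          IsCondExp (matrixFunctional τ.toLinearMap n)
            (matricesOver n ((wstarPolys B X).within M : Set M)) ((τ p)⁻¹ • R) S := by
  obtain ⟨E, hE⟩ := exists_condExp hτ hBM
  have hα := (trace_proj_eq hτ hp hp0).1
  have hS := (isCompressionSetting hτ hBM hp hp0 hfree hind hE).matrix n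
  have hXn : IsSelfAdjoint (amplify n X) := by
    rw [isSelfAdjoint_iff, amplify_star, hX.star_eq]
  have hXC : amplify n X ∈
      matrixSubalgebra n (polys (B.within M) X).topologicalClosure := by
    intro i j
    rw [amplify_apply]
    split_ifs
    · exact Subalgebra.le_topologicalClosure _ (mem_polys_self _ X)
    · exact Subalgebra.zero_mem _
  refine ⟨subordination (matrixHom n (inclusionHom hBM)) (matrixCLM n E) (amplify n p) (τ p).re
    (amplify n X), hS.analyticOnNhd_subordination hXn, fun β hβ => hS.subordination_mem hXn hβ,
    fun β hβ => ⟨cornerResolvent (matrixHom n (inclusionHom hBM)) (amplify n p) (τ p).re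
      (amplify n X) β, subordinateResolvent (matrixHom n (inclusionHom hBM)) (matrixCLM n E)
      (amplify n p) (τ p).re (amplify n X) β, ?_, ?_, ?_, ?_⟩⟩
  · have := hS.isCornerInverse_cornerResolvent hXn hβ
    rwa [amplify_mul, amplify_mul, ← amplify_smul, ← hα] at this
  · exact Ring.mul_inverse_cancel _ (hS.isUnit_sub_subordination hXn hβ)
  · exact Ring.inverse_mul_cancel _ (hS.isUnit_sub_subordination hXn hβ)
  · have hu := hS.isUnit_sub_subordination hXn hβ
    refine ⟨matricesOver_inverse_mem (fun i j => ?_) (Ring.mul_inverse_cancel _ hu)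
      (Ring.inverse_mul_cancel _ hu), fun m hm => ?_⟩
    · rw [CStarMatrix.sub_apply, amplify_apply, matrixHom_apply]
      refine Subalgebra.sub_mem _ ?_ (polys_le_wstarPolys B
        (Algebra.subset_adjoin (Or.inl (inclusionHom_mem_within hBM _))))
      split_ifs
      · exact polys_le_wstarPolys B (mem_polys_self _ X)
      · exact Subalgebra.zero_mem _
    · have h := matrixFunctional_mul_eq_zero hτ B hX (n := n)
        (y := subordinateResolvent (matrixHom n (inclusionHom hBM)) (matrixCLM n E)
          (amplify n p) (τ p).re (amplify n X) β - (τ p)⁻¹ •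
          cornerResolvent (matrixHom n (inclusionHom hBM)) (amplify n p) (τ p).re
            (amplify n X) β) (fun d hd => ?_) hm
      · rwa [sub_mul, map_sub, sub_eq_zero] at h
      · have h1 := hS.trace_cornerResolvent_eq hXn hXC hβ (m := d)
          fun i j => Subalgebra.le_topologicalClosure _ (hd i j)
        rw [sub_mul, map_sub, sub_eq_zero, hα]
        exact h1.symm
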